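/- Let $n\ge 1$, $m:=\lfloor n/2\rfloor$ and let $S_n$ be the group of permutations of $[n]=\{1,\dots,n\}$. For $\sigma\in S_n$ let $\ell(\sigma)$ be the number of pairs $(i,j)\in[n]^2$ with $i<j$ and $\sigma(i)>\sigma(j)$, let $L(\sigma)$ be the number of those pairs with moreover $i\not\equiv j\pmod 2$, and let $D(\sigma)=\{i\in[n-1] : \sigma(i)>\sigma(i+1)\}$. Put $$C_{n,+}=\{\sigma\in S_n : i+\sigma(i)\equiv 0 \!\!\pmod 2\ \text{for all } i\},\qquad C_{n,-}=\{\sigma\in S_n : i+\sigma(i)\equiv 1\!\! \pmod 2\ \text{for all } i\},$$ and for $X\subseteq S_n$ and $I,J\subseteq[n-1]$ put $\mathcal D^I_J(X)=\{\sigma\in X : J\subseteq D(\sigma)\subseteq[n-1]\setminus I\}$. Let $I,J\subseteq[n-1]$ be unmixed, i.e. $I\cap J=(I+1)\cap J=I\cap(J+1)=\emptyset$. Let $I_1,\dots,I_s$ be the connected components of $I$ and $J_1,\dots,J_t$ those of $J$ (the maximal nonempty intervals of consecutive integers contained in the set). Put $b_j=\lfloor\frac{|I_j|+1}{2}\rfloor$,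 $d_k=\lfloor\frac{|J_k|+1}{2}\rfloor$, $\tilde b=\sum_j b_j$, $\tilde d=\sum_k d_k$, $M=\tilde b+\tilde d$ and $\alpha(J)=\sum_k d_k^2$. Let $[r]_q=\frac{1-q^r}{1-q}$, $[r]_q!=\prod_{i=1}^r[i]_q$, and $$\left[\begin{smallmatrix}M\\ \mathbf b,\mathbf d\end{smallmatrix}\right]_{q}=\frac{[M]_q!}{\prod_j[b_j]_q!\,\prod_k[d_k]_q!}.$$ Then the following identities of rational functions in the indeterminate $x$ hold. If $n$ is odd, $$\sum_{\sigma\in\mathcal D^I_J(C_{n,+})}(-1)^{\ell(\sigma)}x^{L(\sigma)}=(-x)^{\tilde d}x^{\alpha(J)}\left[\begin{smallmatrix}M\\ \mathbf b,\mathbf d\end{smallmatrix}\right]_{x^2}\prod_{k=M+1}^{m}(1-x^{2k}).$$ If $n$ is even, $$\sum_{\sigma\in\mathcal D^I_J(C_{n,+})}(-1)^{\ell(\sigma)}x^{L(\sigma)}=\begin{cases}(-x)^{\tilde d}x^{\alpha(J)}\dfrac{[\tilde b]_{x^2}}{[m]_{x^2}}\left[\begin{smallmatrix}M\\ \mathbf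 b,\mathbf d\end{smallmatrix}\right]_{x^2},&\text{if } m=M,\\[2mm](-x)^{\tilde d}x^{\alpha(J)}\left[\begin{smallmatrix}M\\ \mathbf b,\mathbf d\end{smallmatrix}\right]_{x^2}\displaystyle\prod_{k=M+1}^{m-1}(1-x^{2k}),&\text{otherwise,}\end{cases}$$ and $$\sum_{\sigma\in\mathcal D^I_J(C_{n,-})}(-1)^{\ell(\sigma)}x^{L(\sigma)}=\begin{cases}(-1)^{\tilde d}x^{\tilde b+\alpha(J)}\dfrac{[\tilde d]_{x^2}}{[m]_{x^2}}\left[\begin{smallmatrix}M\\ \mathbf b,\mathbf d\end{smallmatrix}\right]_{x^2},&\text{if } m=M,\\[2mm]-(-x)^{\tilde d}x^{m+\alpha(J)}\left[\begin{smallmatrix}M\\ \mathbf b,\mathbf d\end{smallmatrix}\right]_{x^2}\displaystyle\prod_{k=M+1}^{m-1}(1-x^{2k}),&\text{otherwise.}\end{cases}$$ (Empty products are $1$.) -/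

import Mathlib

open scoped Polynomial

namespace OddLength

/-! ### The symmetric group `S_n`

`S_n` is `Equiv.Perm (Fin n)`: the position (or value) `i ∈ [n]` is the element of `Fin n`
whose underlying natural number is `i - 1`. -/

/-- The Coxeter length `ℓ(σ)`, i.e. the number of inversions of `σ`. -/
def len {n : ℕ} (σ : Equiv.Perm (Fin n)) : ℕ :=
  (Finset.univ.filter fun p : Fin n × Fin n => p.1 < p.2 ∧ σ p.2 < σ p.1).card

/-- The odd length `L(σ)`: the number of inversions between positions of opposite parity. -/
def oddLen {n : ℕ} (σ : Equiv.Perm (Fin n)) : ℕ :=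
  (Finset.univ.filter fun p : Fin n × Fin n =>
    p.1 < p.2 ∧ σ p.2 < σ p.1 ∧ ¬ ((p.1 : ℕ) ≡ (p.2 : ℕ) [MOD 2])).card

/-- The descent set `D(σ) = {i ∈ [n-1] | σ(i) > σ(i+1)}`, with positions numbered from `1`. -/
def descents {n : ℕ} (σ : Equiv.Perm (Fin n)) : Finset ℕ :=
  (Finset.Icc 1 (n - 1)).filter fun i =>
    ∃ p q : Fin n, (p : ℕ) + 1 = i ∧ (q : ℕ) + 1 = i + 1 ∧ σ q < σ p

/-- The even chessboard elements `C_{n,+}`: `i + σ(i)` is even for all `i ∈ [n]`. -/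
def evenChess (n : ℕ) : Finset (Equiv.Perm (Fin n)) :=
  Finset.univ.filter fun σ => ∀ i : Fin n, ((i : ℕ) + 1) + ((σ i : ℕ) + 1) ≡ 0 [MOD 2]

/-- The odd chessboard elements `C_{n,-}`: `i + σ(i)` is odd for all `i ∈ [n]`. -/
def oddChess (n : ℕ) : Finset (Equiv.Perm (Fin n)) :=
  Finset.univ.filter fun σ => ∀ i : Fin n, ((i : ℕ) + 1) + ((σ i : ℕ) + 1) ≡ 1 [MOD 2]

/-- The descent class `𝒟^I_J(X) = {σ ∈ X | J ⊆ D(σ) ⊆ [n-1] \ I}`: ascents at the positions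
in `I`, descents at the positions in `J`. -/
def descentClass {n : ℕ} (I J : Finset ℕ) (X : Finset (Equiv.Perm (Fin n))) :
    Finset (Equiv.Perm (Fin n)) :=
  X.filter fun σ => J ⊆ descents σ ∧ descents σ ⊆ Finset.Icc 1 (n - 1) \ I

/-- `∑_{σ ∈ X} (-1)^{ℓ(σ)} x^{L(σ)}`, a polynomial with integer coefficients. -/
noncomputable def signedGF {n : ℕ} (X : Finset (Equiv.Perm (Fin n))) : ℤ[X] :=
  ∑ σ ∈ X, (-1) ^ len σ * Polynomial.X ^ oddLen σ

/-! ### Sets of positions -/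

/-- `I ∩ J = (I+1) ∩ J = I ∩ (J+1) = ∅`. -/
def Unmixed (I J : Finset ℕ) : Prop :=
  I ∩ J = ∅ ∧ I.image (· + 1) ∩ J = ∅ ∧ I ∩ J.image (· + 1) = ∅

/-- The connected components of `I`: the maximal nonempty intervals `[a,b]` contained in `I`. -/
def components (I : Finset ℕ) : Finset (Finset ℕ) :=
  ((I ×ˢ I).filter fun p =>
    p.1 ≤ p.2 ∧ Finset.Icc p.1 p.2 ⊆ I ∧ (∀ c ∈ I, c + 1 ≠ p.1) ∧ p.2 + 1 ∉ I).image
      fun p => Finset.Icc p.1 p.2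

/-- The multiset of the numbers `⌊(|I_j|+1)/2⌋`, where `I_1, …, I_s` are the connected components
of `I`. -/
def parts (I : Finset ℕ) : Multiset ℕ :=
  (components I).val.map fun K => (K.card + 1) / 2

/-! ### `q`-analogues -/

section
variable {K : Type*} [Field K]

/-- `[n]_q = (1 - q^n) / (1 - q)`. -/
def qInt (q : K) (n : ℕ) : K := (1 - q ^ n) / (1 - q)

/-- `[n]_q! = [1]_q [2]_q ⋯ [n]_q`. -/
def qFactorial (q : K) (n : ℕ) : K := ∏ i ∈ Finset.Icc 1 n, qInt q i

/-- The `q`-multinomial coefficient `[n]_q! / ([n_1]_q! ⋯ [n_k]_q!)`, for a multiset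
`{n_1, …, n_k}` with sum `n`. -/
def qMultinomial (q : K) (n : ℕ) (s : Multiset ℕ) : K :=
  qFactorial q n / (s.map (qFactorial q)).prod

end

end OddLength

/-! Insert the values in increasing order, so that `σ⁻¹` is read as a word of positions. The
chessboard condition says that the parities of these positions alternate, starting with a parity `e`
that separates `C_{n,+}` from `C_{n,-}`. The prescribed ascents and descents cut the positions into
blocks, filled from left to right or from right to left, and the summand is a product over
inversions of weights depending only on the parities of the two positions. Removing the largest
value gives a recursion (`fillingSum_succ`): a sum over the removable positions of the right parity,
each weighted by the filled positions to its right.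

This recursion is realised by 2×2 matrices. Within a block the letters form an alternating word,
represented up to a scalar by `altMat`. The map `u ↦ uY - cYu` strips the last letter of such a word
if the parity fits and kills it otherwise (`twistedDer_altMat`). By its twisted Leibniz rule
(`twistedDer_mul`) it reproduces the recursion on ordered products of block matrices
(`twistedDer_prodMat`). A linear functional compatible with these maps (`altCoeff_twistedDer`) then
turns the sum over permutations into `altCoeff` of one explicit product (`fillingSum_eq_altCoeff`).

For full blocks that product has at most two nonzero entries (`prodMat_range`). If `o` blocks have
odd length, then `m - M = ⌊o/2⌋`. The second diagonal entry survives only for `o = 0`, which for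
even `n` is the exceptional case `m = M`. -/

namespace OddLength

/-! ### Matrices of alternating words and of single blocks. -/

section Matrices
variable {K : Type*} [Field K]

/-- The weight of an inversion between positions `i` and `j`: `-1` for equal parities,
`-x` otherwise. -/
def pairWeight (x : K) (i j : ℕ) : K := if i % 2 = j % 2 then -1 else -x

theorem pairWeight_congr (x : K) {i i' j j' : ℕ} (hi : i % 2 = i' % 2) (hj : j % 2 = j' % 2) :
    pairWeight x i j = pairWeight x i' j' := by
  simp only [pairWeight, hi, hj]

theorem qFactorial_zero (q : K) : qFactorial q 0 = 1 := by simp [qFactorial]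

theorem qFactorial_succ (q : K) (k : ℕ) :
    qFactorial q (k + 1) = qFactorial q k * qInt q (k + 1) := by
  simp [qFactorial, Finset.prod_Icc_succ_top]

theorem qInt_ne_zero {q : K} (hq : ∀ k, 1 ≤ k → q ^ k ≠ 1) {k : ℕ} (hk : 1 ≤ k) :
    qInt q k ≠ 0 := by
  have h1 : q ≠ 1 := by simpa using hq 1 le_rfl
  exact div_ne_zero (sub_ne_zero.2 (hq k hk).symm) (sub_ne_zero.2 h1.symm)

theorem qFactorial_ne_zero {q : K} (hq : ∀ k, 1 ≤ k → q ^ k ≠ 1) (k : ℕ) :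
    qFactorial q k ≠ 0 :=
  Finset.prod_ne_zero_iff.2 fun _ hi => qInt_ne_zero hq (Finset.mem_Icc.1 hi).1

/-- The matrix attached to the alternating word with `s` letters whose first letter has the parity
of `p`. -/
def altMat (x : K) (p s : ℕ) : Matrix (Fin 2) (Fin 2) K :=
  (qFactorial (x ^ 2) (s / 2))⁻¹ •
    if p % 2 = 0 then
      if s % 2 = 0 then !![1, 0; 0, x ^ (s / 2)] else !![0, 1; 0, 0]
    else
      if s % 2 = 0 then !![x ^ (s / 2), 0; 0, 1] else !![0, 0; 1 - x ^ 2, 0]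

/-- The matrix that induces the twisted derivation removing a last letter of the parity of `t`. -/
def lastMat (x : K) (t : ℕ) : Matrix (Fin 2) (Fin 2) K :=
  if t % 2 = 0 then !![0, 0; 1, 0] else !![0, (1 - x ^ 2)⁻¹; 0, 0]

/-- The inner derivation `u ↦ u Y - c Y u` twisted by the scalar `c`. -/
def twistedDer (x : K) (t : ℕ) (c : K) (u : Matrix (Fin 2) (Fin 2) K) :
    Matrix (Fin 2) (Fin 2) K :=
  u * lastMat x t - c • (lastMat x t * u)

/-- The two terms `c' u Y v` cancel. Combinatorially, a letter removed from the left factor has to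
pass the right factor, at the cost `c'`. -/
theorem twistedDer_mul (x : K) (t : ℕ) (c c' : K) (u v : Matrix (Fin 2) (Fin 2) K) :
    twistedDer x t (c * c') (u * v) =
      u * twistedDer x t c' v + c' • (twistedDer x t c u * v) := by
  simp only [twistedDer, mul_sub, sub_mul, Matrix.mul_smul, Matrix.smul_mul, smul_sub, smul_smul,
    mul_assoc]
  rw [mul_comm c' c]
  abel

theorem twistedDer_smul (x : K) (t : ℕ) (c a : K) (u : Matrix (Fin 2) (Fin 2) K) :
    twistedDer x t c (a • u) = a • twistedDer x t c u := by
  simp only [twistedDer, Matrix.mul_smul, Matrix.smul_mul, smul_sub]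
  rw [smul_comm]

theorem twistedDer_one (x : K) (t : ℕ) : twistedDer x t 1 1 = 0 := by
  simp [twistedDer]

/-- The weight of a letter `t` passing the alternating word of length `s` starting at `p`. -/
def passWeight (x : K) (t p s : ℕ) : K := ∏ i ∈ Finset.range s, pairWeight x t (p + i)

/-- Two neighbouring positions have opposite parities, hence weights `-1` and `-x` in some order. -/
theorem passWeight_add_two (x : K) (t p s : ℕ) :
    passWeight x t p (s + 2) = x * passWeight x t p s := by
  simp only [passWeight, Finset.prod_range_succ, mul_assoc]
  rw [mul_comm x]
  congr 1
  simp only [pairWeight]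
  rcases Nat.mod_two_eq_zero_or_one t with h | h <;>
  rcases Nat.mod_two_eq_zero_or_one (p + s) with h' | h' <;>
  simp [← add_assoc, Nat.add_mod (p + s) 1, h, h']

theorem passWeight_even (x : K) (t p k : ℕ) : passWeight x t p (2 * k) = x ^ k := by
  induction k with
  | zero => simp [passWeight]
  | succ k ih => rw [mul_add, mul_one, passWeight_add_two, ih, pow_succ']

theorem passWeight_odd (x : K) (t p k : ℕ) :
    passWeight x t p (2 * k + 1) = x ^ k * pairWeight x t p := by
  rw [passWeight, Finset.prod_range_succ, ← passWeight, passWeight_even]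
  congr 1
  exact pairWeight_congr x rfl (by omega)

/-- The scalar counts the removed letter against all letters, itself included. For even length `2k`
a matching letter produces `(1 - x^(2k)) / (1 - x^2)`, which the `q`-factorial in `altMat` absorbs;
with the wrong letter the two terms coincide and cancel. -/
theorem twistedDer_altMat {x : K} (hx : ∀ k, 1 ≤ k → (x ^ 2) ^ k ≠ 1) (t p s : ℕ) :
    twistedDer x t (passWeight x t p (s + 1)) (altMat x p (s + 1)) =
      if t % 2 = (p + s) % 2 then altMat x p s else 0 := by
  have h1 : 1 - x ^ 2 ≠ 0 := sub_ne_zero.2 (by simpa using (hx 1 le_rfl).symm)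
  obtain ⟨k, rfl | rfl⟩ := Nat.even_or_odd' s
  · have e1 : (2 * k + 1) / 2 = k := by omega
    have e2 : (2 * k) / 2 = k := by omega
    have e3 : (2 * k + 1) % 2 = 1 := by omega
    have e4 : (p + 2 * k) % 2 = p % 2 := by omega
    rw [passWeight_odd, altMat, altMat, twistedDer_smul, e1, e2, e3, e4]
    rcases Nat.mod_two_eq_zero_or_one t with h | h <;>
    rcases Nat.mod_two_eq_zero_or_one p with h' | h' <;>
    · ext i j
      fin_cases i <;> fin_cases j <;>
        simp [h, h', twistedDer, lastMat, pairWeight, h1]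
  · have e1 : (2 * k + 1 + 1) / 2 = k + 1 := by omega
    have e2 : (2 * k + 1) / 2 = k := by omega
    have e3 : (2 * k + 1) % 2 = 1 := by omega
    have e4 : (p + (2 * k + 1)) % 2 = (p + 1) % 2 := by omega
    have e5 : 2 * k + 1 + 1 = 2 * (k + 1) := by ring
    have e6 : (2 * k + 1 + 1) % 2 = 0 := by omega
    have h2 : 1 - x ^ (2 * (k + 1)) ≠ 0 := sub_ne_zero.2 (by rw [pow_mul]; exact (hx _ (by omega)).symm)
    have h3 := qFactorial_ne_zero hx k
    rw [altMat, altMat, twistedDer_smul, e1, e2, e3, e4, e6, e5, passWeight_even, qFactorial_succ,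
      qInt, ← pow_mul]
    rcases Nat.mod_two_eq_zero_or_one t with h | h <;>
    rcases Nat.mod_two_eq_zero_or_one p with h' | h' <;>
    · ext i j
      fin_cases i <;> fin_cases j <;>
        simp [h, h', Nat.add_mod p 1, twistedDer, lastMat] <;> field_simp <;> ring

/-- The sign and the power of `x` contributed by the inversions inside a decreasing block. -/
def decScale (x : K) (s : ℕ) : K := (-1) ^ (s / 2) * x ^ (s / 2 * ((s + 1) / 2))

/-- A decreasing block is filled from its right end, so each new letter is inverted with all earlier
ones. Only parities matter, so `p + s` stands for the position `p - s`. -/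
theorem decScale_succ (x : K) (p s : ℕ) :
    decScale x (s + 1) = decScale x s * passWeight x (p + s) p s := by
  obtain ⟨k, rfl | rfl⟩ := Nat.even_or_odd' s
  · have e1 : (2 * k + 1) / 2 = k := by omega
    have e2 : (2 * k) / 2 = k := by omega
    have e3 : (2 * k + 1 + 1) / 2 = k + 1 := by omega
    rw [passWeight_even, decScale, decScale, e1, e2, e3]
    ring
  · have e1 : (2 * k + 1 + 1) / 2 = k + 1 := by omega
    have e2 : (2 * k + 1) / 2 = k := by omega
    have e3 : (2 * k + 1 + 1 + 1) / 2 = k + 1 := by omega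
    have e4 : ¬ (p + (2 * k + 1)) % 2 = p % 2 := by omega
    rw [passWeight_odd, decScale, decScale, e1, e2, e3, pairWeight, if_neg e4]
    ring

/-- The matrix of a block of consecutive positions `[p, p + r)` filled with `s` values, in
increasing order, or in decreasing order if `δ` is true. -/
def blockMat (x : K) (δ : Bool) (p r s : ℕ) : Matrix (Fin 2) (Fin 2) K :=
  if δ then decScale x s • altMat x (p + r - 1) s else altMat x p s

theorem altMat_zero (x : K) (p : ℕ) : altMat x p 0 = 1 := by
  simp [altMat, qFactorial_zero, Matrix.one_fin_two]

theorem blockMat_zero (x : K) (δ : Bool) (p r : ℕ) : blockMat x δ p r 0 = 1 := by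
  simp [blockMat, altMat_zero, decScale]

/-- The initial segment with `s` elements of a block, in the order in which it is filled. -/
def blockSeg (δ : Bool) (p r s : ℕ) : Finset ℕ :=
  if δ then Finset.Ico (p + r - s) (p + r) else Finset.Ico p (p + s)

/-- The precedence relation inside a block. -/
def blockRel (δ : Bool) (i j : ℕ) : Prop := if δ then i = j + 1 else j = i + 1

/-- No element of `S` has to come after `i`. -/
def Removable (R : ℕ → ℕ → Prop) (S : Finset ℕ) (i : ℕ) : Prop := ∀ j ∈ S, ¬ R i j

noncomputable instance (R : ℕ → ℕ → Prop) (S : Finset ℕ) (i : ℕ) : Decidable (Removable R S i) :=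
  Classical.dec _

/-- The position of a block that is filled after `s` other ones. -/
def blockPos (δ : Bool) (p r s : ℕ) : ℕ := if δ then p + r - 1 - s else p + s

theorem card_blockSeg {δ : Bool} {p r s : ℕ} (hs : s ≤ r) : (blockSeg δ p r s).card = s := by
  cases δ <;> simp [blockSeg]
  omega

theorem blockPos_mem {δ : Bool} {p r s : ℕ} (hs : s < r) :
    blockPos δ p r s ∈ blockSeg δ p r (s + 1) := by
  cases δ <;> simp [blockSeg, blockPos] <;> omega

theorem prod_blockSeg (x : K) (t : ℕ) {δ : Bool} {p r s : ℕ} (hs : s ≤ r) :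
    ∏ j ∈ blockSeg δ p r s, pairWeight x t j =
      passWeight x t (if δ then p + r - 1 else p) s := by
  cases δ
  · simp [blockSeg, passWeight, Finset.prod_Ico_eq_prod_range]
  · simp only [blockSeg, if_true, passWeight, Finset.prod_Ico_eq_prod_range]
    have e : p + r - (p + r - s) = s := by omega
    rw [e, ← Finset.prod_range_reflect]
    refine Finset.prod_congr rfl fun i hi => pairWeight_congr x rfl ?_
    have := Finset.mem_range.1 hi
    omega

/-- Inside a block only the position filled last can be removed. -/
theorem filter_blockSeg {δ : Bool} {p r s : ℕ} (t : ℕ) (hs : s < r) :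
    (blockSeg δ p r (s + 1)).filter
        (fun i => i % 2 = t % 2 ∧ Removable (blockRel δ) (blockSeg δ p r (s + 1)) i) =
      if t % 2 = blockPos δ p r s % 2 then {blockPos δ p r s} else ∅ := by
  have key : ∀ i, (i ∈ blockSeg δ p r (s + 1) ∧
      Removable (blockRel δ) (blockSeg δ p r (s + 1)) i) ↔ i = blockPos δ p r s := by
    intro i
    constructor
    · rintro ⟨h1, h2⟩
      cases δ
      · have := h2 (i + 1)
        simp [blockSeg, blockPos, blockRel] at *
        omega
      · have := h2 (i - 1)
        simp [blockSeg, blockPos, blockRel] at *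
        omega
    · rintro rfl
      refine ⟨blockPos_mem hs, fun j hj => ?_⟩
      cases δ <;> simp [blockSeg, blockPos, blockRel] at * <;> omega
  ext i
  rw [Finset.mem_filter]
  have hk := key i
  split_ifs with h
  · rw [Finset.mem_singleton, ← hk]
    constructor
    · rintro ⟨h1, -, h2⟩; exact ⟨h1, h2⟩
    · rintro ⟨h1, h2⟩
      refine ⟨h1, ?_, h2⟩
      rw [hk.1 ⟨h1, h2⟩, h]
  · simp only [Finset.notMem_empty, iff_false]
    rintro ⟨h1, h3, h2⟩
    rw [hk.1 ⟨h1, h2⟩] at h3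
    exact h h3.symm

/-- Only the position filled last is removable, so the sum has at most one term. Its weight is `1`
in an increasing block and the ratio of consecutive values of `decScale` in a decreasing one. -/
theorem twistedDer_blockMat {x : K} (hx : ∀ k, 1 ≤ k → (x ^ 2) ^ k ≠ 1) (t : ℕ) {δ : Bool}
    {p r s : ℕ} (hs : s ≤ r) :
    twistedDer x t (∏ j ∈ blockSeg δ p r s, pairWeight x t j) (blockMat x δ p r s) =
      ∑ i ∈ (blockSeg δ p r s).filter
          (fun i => i % 2 = t % 2 ∧ Removable (blockRel δ) (blockSeg δ p r s) i),
        (∏ j ∈ (blockSeg δ p r s).filter (i < ·), pairWeight x i j) •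
          blockMat x δ p r (s - 1) := by
  cases s with
  | zero =>
    have : blockSeg δ p r 0 = ∅ := by cases δ <;> simp [blockSeg]
    simp [this, blockMat_zero, twistedDer_one]
  | succ s =>
    have hs' : s < r := hs
    rw [filter_blockSeg t hs', prod_blockSeg x t hs, Nat.add_sub_cancel]
    have hpar : blockPos δ p r s % 2 = ((if δ then p + r - 1 else p) + s) % 2 := by
      cases δ <;> simp [blockPos]; omega
    have hprod : ∏ j ∈ (blockSeg δ p r (s + 1)).filter (blockPos δ p r s < ·),
        pairWeight x (blockPos δ p r s) j =
        if δ then passWeight x (blockPos δ p r s) (p + r - 1) s else 1 := by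
      cases δ
      · simp only [Bool.false_eq_true, if_false]
        rw [Finset.filter_false_of_mem, Finset.prod_empty]
        intro i hi
        simp [blockSeg, blockPos] at *
        omega
      · have h := prod_blockSeg x (blockPos true p r s) (δ := true) (p := p) hs'.le
        simp only [if_true] at h ⊢
        rw [← h]
        refine Finset.prod_congr ?_ fun _ _ => rfl
        ext i
        simp [blockSeg, blockPos]
        omega
    have hd := twistedDer_altMat hx t (if δ then p + r - 1 else p) s
    rw [hpar]
    cases δ
    · simp only [Bool.false_eq_true, if_false] at *
      simp only [blockMat, Bool.false_eq_true, if_false, hd]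
      split_ifs <;> simp [hprod]
    · simp only [if_true] at *
      have hp : passWeight x (blockPos true p r s) (p + r - 1) s =
          passWeight x (p + r - 1 + s) (p + r - 1) s :=
        Finset.prod_congr rfl fun _ _ => pairWeight_congr x hpar rfl
      simp only [blockMat, if_true, twistedDer_smul, hd]
      split_ifs
      · simp only [Finset.sum_singleton, hprod, smul_smul, hp]
        rw [decScale_succ x (p + r - 1) s, mul_comm]
      · simp

end Matrices
-- Lists of blocks and the derivation of their matrix product.
theorem eq_blockSeg_of_closed {δ : Bool} {p r : ℕ} {T : Finset ℕ} (hT : T ⊆ Finset.Ico p (p + r))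
    (hc : ∀ i ∈ Finset.Ico p (p + r), ∀ j ∈ T, blockRel δ i j → i ∈ T) :
    ∃ s ≤ r, T = blockSeg δ p r s := by
  induction r generalizing p with
  | zero =>
    refine ⟨0, le_rfl, ?_⟩
    have : T = ∅ := by simpa using hT
    cases δ <;> simp [blockSeg, this]
  | succ r ih =>
    cases δ
    -- If the position filled last lies in `T`, closure under predecessors forces the whole block;
    -- otherwise that position is dropped.
    · by_cases h : p + r ∈ T
      · refine ⟨r + 1, le_rfl, ?_⟩
        simp only [blockSeg, Bool.false_eq_true, if_false]
        refine hT.antisymm fun i hi => ?_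
        rw [Finset.mem_Ico] at hi
        have key : ∀ k ≤ r, p + r - k ∈ T := by
          intro k
          induction k with
          | zero => intro _; exact h
          | succ k ihk =>
            intro hk
            refine hc _ (Finset.mem_Ico.2 (by omega)) _ (ihk (by omega)) ?_
            simp [blockRel]; omega
        have := key (p + r - i) (by omega)
        rwa [show p + r - (p + r - i) = i by omega] at this
      · obtain ⟨s, hs, e⟩ := ih (p := p) (fun i hi => by
          have := Finset.mem_Ico.1 (hT hi)
          have : i ≠ p + r := fun e => h (e ▸ hi)
          exact Finset.mem_Ico.2 (by omega)) (fun i hi => hc i (by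
            have := Finset.mem_Ico.1 hi
            exact Finset.mem_Ico.2 (by omega)))
        exact ⟨s, by omega, by simpa [blockSeg] using e⟩
    · by_cases h : p ∈ T
      · refine ⟨r + 1, le_rfl, ?_⟩
        simp only [blockSeg, if_true, Nat.add_sub_cancel]
        refine hT.antisymm fun i hi => ?_
        rw [Finset.mem_Ico] at hi
        have key : ∀ k ≤ r, p + k ∈ T := by
          intro k
          induction k with
          | zero => intro _; exact h
          | succ k ihk =>
            intro hk
            refine hc _ (Finset.mem_Ico.2 (by omega)) _ (ihk (by omega)) ?_
            simp [blockRel]; omega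
        have := key (i - p) (by omega)
        rwa [show p + (i - p) = i by omega] at this
      · obtain ⟨s, hs, e⟩ := ih (p := p + 1) (fun i hi => by
          have := Finset.mem_Ico.1 (hT hi)
          have : i ≠ p := fun e => h (e ▸ hi)
          exact Finset.mem_Ico.2 (by omega)) (fun i hi => hc i (by
            have := Finset.mem_Ico.1 hi
            exact Finset.mem_Ico.2 (by omega)))
        refine ⟨s, by omega, ?_⟩
        rw [show p + (r + 1) = p + 1 + r by omega] at *
        simpa [blockSeg, show p + (r + 1) = p + 1 + r by omega] using e

/-- The number of positions covered by a list of blocks. The head of the list is the last block;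
a block is given by its length and whether it is decreasing. -/
def totalLen : List (ℕ × Bool) → ℕ
  | [] => 0
  | b :: L => totalLen L + b.1

/-- `listRel L i j`: the value at position `i` has to be smaller than the value at the
neighbouring position `j`. -/
def listRel : List (ℕ × Bool) → ℕ → ℕ → Prop
  | [], _, _ => False
  | b :: L, i, j => listRel L i j ∨
      (i ∈ Finset.Ico (totalLen L) (totalLen L + b.1) ∧
        j ∈ Finset.Ico (totalLen L) (totalLen L + b.1) ∧ blockRel b.2 i j)

theorem lt_of_listRel {L : List (ℕ × Bool)} {i j : ℕ} (h : listRel L i j) :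
    i < totalLen L ∧ j < totalLen L := by
  induction L with
  | nil => exact h.elim
  | cons b L ih =>
    rcases h with h | ⟨h1, h2, -⟩
    · have := ih h
      simp only [totalLen]; omega
    · exact ⟨(Finset.mem_Ico.1 h1).2, (Finset.mem_Ico.1 h2).2⟩

section
variable {K : Type*} [Field K]

/-- The ordered product of the matrices of the blocks of `L`, filled at the positions in `S`. -/
def prodMat (x : K) : List (ℕ × Bool) → Finset ℕ → Matrix (Fin 2) (Fin 2) K
  | [], _ => 1
  | b :: L, S => prodMat x L S *
      blockMat x b.2 (totalLen L) b.1 (S ∩ Finset.Ico (totalLen L) (totalLen L + b.1)).card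

theorem prodMat_congr (x : K) {L : List (ℕ × Bool)} {S S' : Finset ℕ}
    (h : ∀ i < totalLen L, i ∈ S ↔ i ∈ S') : prodMat x L S = prodMat x L S' := by
  induction L with
  | nil => rfl
  | cons b L ih =>
    simp only [totalLen] at h
    rw [prodMat, prodMat, ih fun i hi => h i (by omega)]
    congr 3
    ext i
    simp only [Finset.mem_inter, Finset.mem_Ico]
    constructor
    · rintro ⟨h1, h2⟩; exact ⟨(h i h2.2).1 h1, h2⟩
    · rintro ⟨h1, h2⟩; exact ⟨(h i h2.2).2 h1, h2⟩

/-- The derivation of a product of block matrices is the weighted sum over the removable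
positions. -/
theorem twistedDer_prodMat {x : K} (hx : ∀ k, 1 ≤ k → (x ^ 2) ^ k ≠ 1) (t : ℕ)
    (L : List (ℕ × Bool)) {S : Finset ℕ} (hS : ∀ i j, listRel L i j → j ∈ S → i ∈ S) :
    twistedDer x t (∏ j ∈ S with j < totalLen L, pairWeight x t j) (prodMat x L S) =
      ∑ i ∈ S with i < totalLen L ∧ i % 2 = t % 2 ∧ Removable (listRel L) S i,
        (∏ j ∈ S with i < j ∧ j < totalLen L, pairWeight x i j) • prodMat x L (S.erase i) := by
  induction L with
  | nil => simp [totalLen, prodMat, twistedDer_one]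
  | cons b L ih =>
    obtain ⟨r, δ⟩ := b
    set n := totalLen L with hn
    set T := S ∩ Finset.Ico n (n + r) with hT
    have memT : ∀ i, i ∈ T ↔ i ∈ S ∧ n ≤ i ∧ i < n + r := by simp [hT]
    have htot : totalLen ((r, δ) :: L) = n + r := rfl
    have hrel : ∀ i j, listRel ((r, δ) :: L) i j ↔ listRel L i j ∨
      (i ∈ Finset.Ico n (n + r) ∧ j ∈ Finset.Ico n (n + r) ∧ blockRel δ i j) := fun _ _ => Iff.rfl
    have hprod : ∀ S', prodMat x ((r, δ) :: L) S' = prodMat x L S' *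
      blockMat x δ n r (S' ∩ Finset.Ico n (n + r)).card := fun _ => rfl
    obtain ⟨s, hs, hTs⟩ := eq_blockSeg_of_closed (δ := δ) (p := n) (r := r) (T := T)
      Finset.inter_subset_right (fun i hi j hj hij => by
        have hj' := (memT j).1 hj
        have hi' := Finset.mem_Ico.1 hi
        exact (memT i).2 ⟨hS i j ((hrel i j).2 (Or.inr ⟨hi, Finset.mem_Ico.2 hj'.2, hij⟩)) hj'.1,
          hi'⟩)
    have hcard : T.card = s := by rw [hTs, card_blockSeg hs]
    have hblock := twistedDer_blockMat hx t (δ := δ) (p := n) hs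
    rw [← hTs] at hblock
    have hsplit : ∀ a : ℕ → K, ∏ j ∈ S with j < n + r, a j =
        (∏ j ∈ S with j < n, a j) * ∏ j ∈ T, a j := by
      intro a
      rw [← Finset.prod_union]
      · refine Finset.prod_congr ?_ fun _ _ => rfl
        ext i
        simp only [Finset.mem_filter, Finset.mem_union, memT]
        constructor
        · rintro ⟨h1, h2⟩
          rcases lt_or_ge i n with h | h
          · exact Or.inl ⟨h1, h⟩
          · exact Or.inr ⟨h1, h, h2⟩
        · rintro (⟨h1, h2⟩ | ⟨h1, h2, h3⟩)
          · exact ⟨h1, by omega⟩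
          · exact ⟨h1, h3⟩
      · rw [Finset.disjoint_left]
        intro i hi hi'
        have := (Finset.mem_filter.1 hi).2
        have := ((memT i).1 hi').2
        omega
    have hsets : (S.filter fun i => i < n + r ∧ i % 2 = t % 2 ∧
          Removable (listRel ((r, δ) :: L)) S i) =
        (S.filter fun i => i < n ∧ i % 2 = t % 2 ∧ Removable (listRel L) S i) ∪
          T.filter fun i => i % 2 = t % 2 ∧ Removable (blockRel δ) T i := by
      ext i
      simp only [Finset.mem_filter, Finset.mem_union, memT]
      simp only [Removable, hrel, memT]
      constructor
      · rintro ⟨h1, h2, h3, h4⟩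
        rcases lt_or_ge i n with h | h
        · exact Or.inl ⟨h1, h, h3, fun j hj hij => h4 j hj (Or.inl hij)⟩
        · exact Or.inr ⟨⟨h1, h, h2⟩, h3, fun j hj hij => h4 j hj.1
            (Or.inr ⟨Finset.mem_Ico.2 ⟨h, h2⟩, Finset.mem_Ico.2 hj.2, hij⟩)⟩
      · rintro (⟨h1, h2, h3, h4⟩ | ⟨⟨h1, h2, h2'⟩, h3, h4⟩)
        · refine ⟨h1, by omega, h3, fun j hj hij => ?_⟩
          rcases hij with hij | ⟨hi, -⟩
          · exact h4 j hj hij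
          · have := Finset.mem_Ico.1 hi
            omega
        · refine ⟨h1, h2', h3, fun j hj hij => ?_⟩
          rcases hij with hij | ⟨hi, hj', hij⟩
          · have := (lt_of_listRel hij).1
            omega
          · exact h4 j ⟨hj, Finset.mem_Ico.1 hj'⟩ hij
    rw [htot, hsplit, hprod, ← hT, hcard, twistedDer_mul, hblock,
      ih fun i j hij hj => hS i j ((hrel i j).2 (Or.inl hij)) hj, hsets, Finset.sum_union]
    · rw [add_comm]
      congr 1
      -- Removal from an earlier block: the letter also passes all of `T`, and its weights there
      -- depend only on its parity, which is that of `t`.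
      · rw [Finset.sum_mul, Finset.smul_sum]
        refine Finset.sum_congr rfl fun i hi => ?_
        obtain ⟨hi1, hi2, hi3, -⟩ := Finset.mem_filter.1 hi
        have e1 : S.erase i ∩ Finset.Ico n (n + r) = T := by
          ext j
          simp only [Finset.mem_inter, Finset.mem_erase, memT, Finset.mem_Ico]
          constructor
          · rintro ⟨⟨-, h1⟩, h2⟩; exact ⟨h1, h2⟩
          · rintro ⟨h1, h2⟩; exact ⟨⟨by omega, h1⟩, h2⟩
        have e2 : ∏ j ∈ S with i < j ∧ j < n + r, pairWeight x i j =
            (∏ j ∈ S with i < j ∧ j < n, pairWeight x i j) * ∏ j ∈ T, pairWeight x t j := by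
          have h := hsplit fun j => if i < j then pairWeight x i j else 1
          rw [← Finset.prod_filter, ← Finset.prod_filter, Finset.filter_filter,
            Finset.filter_filter] at h
          simp only [and_comm (b := i < _)] at h
          rw [h]
          congr 1
          refine Finset.prod_congr rfl fun j hj => ?_
          have := ((memT j).1 hj).2
          rw [if_pos (by omega)]
          exact pairWeight_congr x hi3 rfl
        rw [hprod, e1, hcard, e2, Matrix.smul_mul, smul_smul, mul_comm]
      -- Removal from the last block: the earlier blocks lie to the left and contribute no weight.
      · rw [Finset.mul_sum]
        refine Finset.sum_congr rfl fun i hi => ?_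
        obtain ⟨hi1, hi2, -⟩ := Finset.mem_filter.1 hi
        obtain ⟨hi1', hi3, hi4⟩ := (memT i).1 hi1
        have e1 : S.erase i ∩ Finset.Ico n (n + r) = T.erase i := by
          rw [hT, Finset.erase_inter]
        have e2 : (S.filter fun j => i < j ∧ j < n + r) = T.filter (i < ·) := by
          ext j
          simp only [Finset.mem_filter, memT]
          constructor
          · rintro ⟨h1, h2, h3⟩; exact ⟨⟨h1, by omega, h3⟩, h2⟩
          · rintro ⟨⟨h1, h2, h3⟩, h4⟩; exact ⟨h1, h4, h3⟩
        have e3 : prodMat x L (S.erase i) = prodMat x L S := by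
          refine prodMat_congr x fun j hj => ?_
          rw [Finset.mem_erase]
          exact ⟨fun h => h.2, fun h => ⟨by omega, h⟩⟩
        rw [hprod, e1, e2, e3, Finset.card_erase_of_mem hi1, hcard, Matrix.mul_smul]
    · rw [Finset.disjoint_left]
      intro i hi hi'
      have := (Finset.mem_filter.1 hi).2.1
      have := ((memT i).1 (Finset.mem_filter.1 hi').1).2
      omega

end
-- Fillings of a set of positions and their recursion.
section
variable {K : Type*} [Field K] {α : Type*} [LinearOrder α]

/-- `τ` enumerates `S` in an order compatible with `R`, and its `v`-th element satisfies `c v`. -/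
structure IsFilling (c : ℕ → α → Prop) (R : α → α → Prop) {k : ℕ} (τ : Fin k → α)
    (S : Finset α) : Prop where
  inj : Function.Injective τ
  mem_iff : ∀ a, a ∈ S ↔ ∃ v, τ v = a
  letter : ∀ v : Fin k, c v (τ v)
  lt_of_rel : ∀ u v, R (τ u) (τ v) → u < v

theorem isFilling_snoc {c : ℕ → α → Prop} {R : α → α → Prop} {k : ℕ} {τ : Fin k → α} {a : α}
    {S : Finset α} :
    IsFilling c R (Fin.snoc τ a : Fin (k + 1) → α) S ↔
      (a ∈ S ∧ c k a ∧ ∀ j ∈ S, ¬ R a j) ∧ IsFilling c R τ (S.erase a) := by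
  constructor
  · intro h
    have ha : a ∈ S := (h.mem_iff a).2 ⟨Fin.last k, by simp⟩
    have hne : ∀ v, τ v ≠ a := fun v e => by
      have := h.inj (a₁ := v.castSucc) (a₂ := Fin.last k) (by simp [e])
      exact absurd this (Fin.castSucc_lt_last v).ne
    refine ⟨⟨ha, by simpa using h.letter (Fin.last k), fun j hj hR => ?_⟩, ?_, ?_, ?_, ?_⟩
    · obtain ⟨v, hv⟩ := (h.mem_iff j).1 hj
      have := h.lt_of_rel (Fin.last k) v (by simpa [hv] using hR)
      exact absurd this (Fin.le_last v).not_gt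
    · intro u v e
      exact Fin.castSucc_injective k (h.inj (by simpa using e))
    · intro b
      rw [Finset.mem_erase, h.mem_iff]
      constructor
      · rintro ⟨hb, v, hv⟩
        induction v using Fin.lastCases with
        | last => exact absurd (by simpa using hv.symm) hb
        | cast v => exact ⟨v, by simpa using hv⟩
      · rintro ⟨v, hv⟩
        exact ⟨hv ▸ hne v, v.castSucc, by simpa using hv⟩
    · intro v
      simpa using h.letter v.castSucc
    · intro u v hR
      simpa using h.lt_of_rel u.castSucc v.castSucc (by simpa using hR)
  · rintro ⟨⟨ha, hc, hR⟩, h⟩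
    have hne : ∀ v, τ v ∈ S ∧ τ v ≠ a := fun v => by
      have := (h.mem_iff (τ v)).2 ⟨v, rfl⟩
      rw [Finset.mem_erase] at this
      exact this.symm
    refine ⟨?_, ?_, ?_, ?_⟩
    · intro u v
      induction u using Fin.lastCases with
      | last =>
        induction v using Fin.lastCases with
        | last => simp
        | cast v => simpa using fun e : a = τ v => absurd e.symm (hne v).2
      | cast u =>
        induction v using Fin.lastCases with
        | last => simpa using fun e : τ u = a => absurd e (hne u).2
        | cast v => simpa using fun e => h.inj e
    · intro b
      constructor
      · intro hb
        by_cases e : b = a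
        · exact ⟨Fin.last k, by simp [e]⟩
        · obtain ⟨v, hv⟩ := (h.mem_iff b).1 (Finset.mem_erase.2 ⟨e, hb⟩)
          exact ⟨v.castSucc, by simpa using hv⟩
      · rintro ⟨v, rfl⟩
        induction v using Fin.lastCases with
        | last => simpa using ha
        | cast v => simpa using (hne v).1
    · intro v
      induction v using Fin.lastCases with
      | last => simpa using hc
      | cast v => simpa using h.letter v
    · intro u v
      induction u using Fin.lastCases with
      | last =>
        induction v using Fin.lastCases with
        | last => simpa using fun e => hR a ha e
        | cast v => simpa using fun e => absurd e (hR _ (hne v).1)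
      | cast u =>
        induction v using Fin.lastCases with
        | last => simp
        | cast v => simpa using h.lt_of_rel u v

/-- The product of the weights of the inversions of `τ`. -/
def invWeight (w : α → α → K) {k : ℕ} (τ : Fin k → α) : K :=
  ∏ v, ∏ u, if u < v ∧ τ v < τ u then w (τ v) (τ u) else 1

/-- The last entry carries the largest value, so its inversions are exactly those with the elements
of `S` to its right. -/
theorem invWeight_snoc (w : α → α → K) {c : ℕ → α → Prop} {R : α → α → Prop} {k : ℕ}
    {τ : Fin k → α} {a : α} {S : Finset α} (h : IsFilling c R τ (S.erase a)) :
    invWeight w (Fin.snoc τ a : Fin (k + 1) → α) =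
      (∏ j ∈ S with a < j, w a j) * invWeight w τ := by
  rw [invWeight, Fin.prod_univ_castSucc, mul_comm]
  congr 1
  · rw [Fin.prod_univ_castSucc]
    simp only [Fin.snoc_last, Fin.snoc_castSucc, lt_irrefl, false_and, if_false, mul_one,
      Fin.castSucc_lt_last, true_and]
    rw [← Finset.prod_filter]
    refine Finset.prod_bij (fun u _ => τ u) ?_ ?_ ?_ ?_
    · intro u hu
      have := (h.mem_iff (τ u)).2 ⟨u, rfl⟩
      exact Finset.mem_filter.2 ⟨Finset.mem_of_mem_erase this, (Finset.mem_filter.1 hu).2⟩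
    · intro u _ v _ e
      exact h.inj e
    · intro j hj
      obtain ⟨hj, haj⟩ := Finset.mem_filter.1 hj
      obtain ⟨u, hu⟩ := (h.mem_iff j).1 (Finset.mem_erase.2 ⟨haj.ne', hj⟩)
      exact ⟨u, by simpa [hu] using haj, hu⟩
    · intro _ _; rfl
  · rw [invWeight]
    refine Finset.prod_congr rfl fun v _ => ?_
    rw [Fin.prod_univ_castSucc]
    simp [not_lt_of_ge (Fin.le_last _)]

open Classical in
/-- The weighted number of fillings of `S`. -/
noncomputable def fillingSum [Fintype α] (w : α → α → K) (c : ℕ → α → Prop) (R : α → α → Prop) (k : ℕ)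
    (S : Finset α) : K :=
  ∑ τ : Fin k → α, if IsFilling c R τ S then invWeight w τ else 0

theorem fillingSum_zero [Fintype α] (w : α → α → K) (c : ℕ → α → Prop) (R : α → α → Prop) :
    fillingSum w c R 0 ∅ = 1 := by
  have : IsFilling c R (default : Fin 0 → α) ∅ :=
    ⟨fun u => u.elim0, by simp, fun u => u.elim0, fun u => u.elim0⟩
  rw [fillingSum, Fintype.sum_unique, if_pos this]
  simp [invWeight]

open Classical in
theorem fillingSum_succ [Fintype α] (w : α → α → K) (c : ℕ → α → Prop) (R : α → α → Prop) (k : ℕ)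
    (S : Finset α) :
    fillingSum w c R (k + 1) S =
      ∑ a ∈ S with c k a ∧ ∀ j ∈ S, ¬ R a j,
        (∏ j ∈ S with a < j, w a j) * fillingSum w c R k (S.erase a) := by
  have h1 : fillingSum w c R (k + 1) S = ∑ a : α, ∑ τ : Fin k → α,
      if IsFilling c R (Fin.snoc τ a : Fin (k + 1) → α) S then
        invWeight w (Fin.snoc τ a : Fin (k + 1) → α) else 0 := by
    rw [fillingSum, ← Fintype.sum_prod_type']
    exact (Fintype.sum_equiv (Fin.snocEquiv fun _ => α) _ _ fun _ => rfl).symm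
  rw [h1, ← Finset.sum_subset (Finset.subset_univ
    (S.filter fun a => c k a ∧ ∀ j ∈ S, ¬ R a j))]
  · refine Finset.sum_congr rfl fun a ha => ?_
    rw [fillingSum, Finset.mul_sum]
    refine Finset.sum_congr rfl fun τ _ => ?_
    simp only [isFilling_snoc, ← Finset.mem_filter (p := fun a => c k a ∧ ∀ j ∈ S, ¬ R a j), ha,
      true_and, mul_ite, mul_zero]
    split_ifs with h
    · exact invWeight_snoc w h
    · rfl
  · intro a _ ha
    refine Finset.sum_eq_zero fun τ _ => if_neg fun h => ha ?_
    exact Finset.mem_filter.2 (isFilling_snoc.1 h).1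

end
-- Permutations in a descent class as fillings.
section
variable {n : ℕ}

theorem mem_descents {σ : Equiv.Perm (Fin n)} {i j : Fin n} (hij : (j : ℕ) = i + 1) :
    (i : ℕ) + 1 ∈ descents σ ↔ σ j < σ i := by
  rw [descents, Finset.mem_filter, Finset.mem_Icc]
  constructor
  · rintro ⟨-, p, q, hp, hq, h⟩
    have e1 : p = i := Fin.ext (by omega)
    have e2 : q = j := Fin.ext (by omega)
    rwa [e1, e2] at h
  · intro h
    exact ⟨⟨by omega, by omega⟩, i, j, rfl, by omega, h⟩

/-- The precedence relation given by ascents at the (one-based) positions in `I` and descents at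
those in `J`. -/
def descentRel (I J : Finset ℕ) (i j : ℕ) : Prop :=
  (i + 1 ∈ I ∧ j = i + 1) ∨ (j + 1 ∈ J ∧ i = j + 1)

theorem mem_descentClass {I J : Finset ℕ}
    (hJ : J ⊆ Finset.Icc 1 (n - 1)) {X : Finset (Equiv.Perm (Fin n))} {σ : Equiv.Perm (Fin n)} :
    σ ∈ descentClass I J X ↔
      σ ∈ X ∧ ∀ i j : Fin n, descentRel I J i j → σ i < σ j := by
  rw [descentClass, Finset.mem_filter]
  refine and_congr_right fun _ => ?_
  constructor
  · rintro ⟨h1, h2⟩ i j (⟨hi, hj⟩ | ⟨hj, hi⟩)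
    · have hd : (i : ℕ) + 1 ∉ descents σ := fun h => (Finset.mem_sdiff.1 (h2 h)).2 hi
      rw [mem_descents hj, not_lt] at hd
      exact lt_of_le_of_ne hd fun e => by
        have := congrArg Fin.val (σ.injective e)
        omega
    · exact (mem_descents hi).1 (h1 hj)
  · intro h
    constructor
    · intro a ha
      have := Finset.mem_Icc.1 (hJ ha)
      have e := mem_descents (σ := σ) (i := ⟨a - 1, by omega⟩) (j := ⟨a, by omega⟩)
        (by simp only; omega)
      simp only [Nat.sub_add_cancel this.1] at e
      exact e.2 (h _ _ (Or.inr ⟨by simpa [Nat.sub_add_cancel this.1] using ha,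
        by simp only; omega⟩))
    · intro a ha
      have ha' : a ∈ Finset.Icc 1 (n - 1) := (Finset.mem_filter.1 ha).1
      have := Finset.mem_Icc.1 ha'
      refine Finset.mem_sdiff.2 ⟨ha', fun haI => ?_⟩
      have e := mem_descents (σ := σ) (i := ⟨a - 1, by omega⟩) (j := ⟨a, by omega⟩)
        (by simp only; omega)
      simp only [Nat.sub_add_cancel this.1] at e
      exact (e.1 ha).not_gt (h _ _ (Or.inl ⟨by simpa [Nat.sub_add_cancel this.1] using haI,
        by simp only; omega⟩))

variable {K : Type*} [Field K]

/-- Every inversion contributes `-1`, and a further `x` when the parities differ. Indexing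
inversions by values instead of positions brings in the inverse. -/
theorem sign_mul_pow_eq_invWeight (x : K) (σ : Equiv.Perm (Fin n)) :
    (-1) ^ len σ * x ^ oddLen σ =
      invWeight (fun i j : Fin n => pairWeight x i j) (σ.symm : Fin n → Fin n) := by
  have h1 : (-1) ^ len σ * x ^ oddLen σ =
      ∏ p : Fin n × Fin n, if p.1 < p.2 ∧ σ p.2 < σ p.1 then pairWeight x p.1 p.2 else 1 := by
    have e : (Finset.univ.filter fun p : Fin n × Fin n =>
        p.1 < p.2 ∧ σ p.2 < σ p.1 ∧ ¬ ((p.1 : ℕ) ≡ (p.2 : ℕ) [MOD 2])) =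
        (Finset.univ.filter fun p : Fin n × Fin n => p.1 < p.2 ∧ σ p.2 < σ p.1).filter
          fun p => ¬ ((p.1 : ℕ) ≡ (p.2 : ℕ) [MOD 2]) := by
      rw [Finset.filter_filter]
      simp only [and_assoc]
    rw [oddLen, e, len, ← Finset.prod_const, ← Finset.prod_const, Finset.prod_filter _
      (fun _ => x), ← Finset.prod_mul_distrib, ← Finset.prod_filter]
    refine Finset.prod_congr rfl fun p _ => ?_
    by_cases h : (p.1 : ℕ) % 2 = p.2 % 2 <;> simp [pairWeight, Nat.ModEq, h]
  rw [h1, invWeight, ← Fintype.prod_prod_type']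
  refine Fintype.prod_equiv (Equiv.prodCongr σ σ) _ _ fun p => ?_
  simp [and_comm]

open Classical in
theorem sum_perm_eq_fillingSum (w : Fin n → Fin n → K) (c : ℕ → Fin n → Prop)
    (R : Fin n → Fin n → Prop) {X : Finset (Equiv.Perm (Fin n))}
    (hX : ∀ σ, σ ∈ X ↔ (∀ i, c (σ i) i) ∧ ∀ i j, R i j → σ i < σ j) :
    ∑ σ ∈ X, invWeight w (σ.symm : Fin n → Fin n) = fillingSum w c R n Finset.univ := by
  rw [fillingSum, ← Finset.sum_filter]
  refine Finset.sum_bij (fun σ _ => (σ.symm : Fin n → Fin n)) ?_ ?_ ?_ ?_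
  · intro σ hσ
    obtain ⟨h1, h2⟩ := (hX σ).1 hσ
    refine Finset.mem_filter.2 ⟨Finset.mem_univ _, σ.symm.injective, fun a => ?_, fun v => ?_,
      fun u v huv => ?_⟩
    · simpa using ⟨σ a, by simp⟩
    · simpa using h1 (σ.symm v)
    · simpa using h2 _ _ huv
  · intro σ _ σ' _ h
    exact Equiv.symm_bijective.injective (Equiv.coe_fn_injective h)
  · intro τ hτ
    have h := (Finset.mem_filter.1 hτ).2
    let ρ := Equiv.ofBijective τ (Finite.injective_iff_bijective.1 h.inj)
    refine ⟨ρ.symm, (hX _).2 ⟨fun i => ?_, fun i j hij => ?_⟩, rfl⟩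
    · have := h.letter (ρ.symm i)
      rwa [show τ (ρ.symm i) = i from ρ.apply_symm_apply i] at this
    · refine h.lt_of_rel _ _ ?_
      rwa [show τ (ρ.symm i) = i from ρ.apply_symm_apply i,
        show τ (ρ.symm j) = j from ρ.apply_symm_apply j]
  · intro _ _; rfl

theorem aeval_signedGF [Algebra ℤ K] (x : K) {I J : Finset ℕ}
    (hJ : J ⊆ Finset.Icc 1 (n - 1)) (ε : ℕ) {X : Finset (Equiv.Perm (Fin n))}
    (hX : ∀ σ, σ ∈ X ↔ ∀ i : Fin n, ((σ i : ℕ) + ε) % 2 = i % 2) :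
    Polynomial.aeval x (signedGF (descentClass I J X)) =
      fillingSum (fun i j : Fin n => pairWeight x i j) (fun v i => (v + ε) % 2 = i % 2)
        (fun i j => descentRel I J i j) n Finset.univ := by
  rw [← sum_perm_eq_fillingSum (X := descentClass I J X), signedGF, map_sum]
  · refine Finset.sum_congr rfl fun σ _ => ?_
    rw [← sign_mul_pow_eq_invWeight]
    simp
  · intro σ
    rw [mem_descentClass hJ, hX]

end
-- The functional that evaluates the recursion.
section
variable {K : Type*} [Field K]

/-- The functional reading off, from a matrix of degree `k`, the coefficient of the alternating
word with `k` letters whose first letter has the parity of `e`. -/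
def altCoeff (x : K) (e : Fin 2) (k : ℕ) (M : Matrix (Fin 2) (Fin 2) K) : K :=
  if k = 0 then M e e
  else if k % 2 = 1 then
    qFactorial (x ^ 2) (k / 2) * M e (1 - e) * (if e = 0 then 1 else (1 - x ^ 2)⁻¹)
  -- The factor `x ^ (k / 2)` makes the functional vanish on the alternating word starting with the
  -- other parity; the prefactor gives value `1` on the one starting with `e`.
  else qFactorial (x ^ 2) (k / 2 - 1) * (M e e - x ^ (k / 2) * M (1 - e) (1 - e)) / (1 - x ^ 2)

theorem altCoeff_sum_smul (x : K) (e : Fin 2) (k : ℕ) {ι : Type*} (s : Finset ι) (a : ι → K)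
    (M : ι → Matrix (Fin 2) (Fin 2) K) :
    altCoeff x e k (∑ i ∈ s, a i • M i) = ∑ i ∈ s, a i * altCoeff x e k (M i) := by
  unfold altCoeff
  split_ifs
  all_goals
    simp only [Matrix.sum_apply, Matrix.smul_apply, smul_eq_mul, Finset.mul_sum, Finset.sum_mul,
      ← Finset.sum_sub_distrib, Finset.sum_div]
  all_goals
    refine Finset.sum_congr rfl fun i _ => ?_
    ring

/-- The scalar is the weight of the last letter `k + e` against all `k + 1` letters of the
alternating word, itself included. The identity holds for every matrix, so the functional can be
applied to products. -/
theorem altCoeff_twistedDer {x : K} (hx : ∀ k, 1 ≤ k → (x ^ 2) ^ k ≠ 1) (e : Fin 2) (k : ℕ)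
    (M : Matrix (Fin 2) (Fin 2) K) :
    altCoeff x e k (twistedDer x (k + e)
        ((-1) ^ ((k + (k + 1) % 2 + 1) / 2) * (-x) ^ ((k + 1) / 2)) M) =
      altCoeff x e (k + 1) M := by
  have h1 : 1 - x ^ 2 ≠ 0 := sub_ne_zero.2 (by simpa using (hx 1 le_rfl).symm)
  obtain ⟨j, rfl | rfl⟩ := Nat.even_or_odd' k
  · have e1 : (2 * j + (2 * j + 1) % 2 + 1) / 2 = j + 1 := by omega
    have e2 : (2 * j + 1) / 2 = j := by omega
    have e3 : (2 * j + 1) % 2 = 1 := by omega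
    have hl : lastMat x (2 * j + e) = lastMat x e := by
      simp only [lastMat, show (2 * j + (e : ℕ)) % 2 = e % 2 by omega]
    rw [e1, e2, twistedDer, hl]
    rcases j with _ | j
    · fin_cases e <;>
        simp [altCoeff, lastMat, Matrix.mul_apply, Matrix.vecMul, dotProduct,
          Fin.sum_univ_two, qFactorial_zero]
    · have e4 : (2 * (j + 1) + 1) / 2 = j + 1 := by omega
      have h2 : 1 - x ^ (2 * (j + 1)) ≠ 0 :=
        sub_ne_zero.2 (by rw [pow_mul]; exact (hx _ (by omega)).symm)
      have hs : (-1 : K) ^ (j + 1 + 1) * (-x) ^ (j + 1) = - x ^ (j + 1) := by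
        rw [neg_pow x, ← mul_assoc, ← pow_add, show j + 1 + 1 + (j + 1) = 2 * (j + 1) + 1 by ring,
          pow_succ, pow_mul]
        simp
      rw [hs]
      fin_cases e <;>
        simp [altCoeff, lastMat, Matrix.mul_apply, Matrix.vecMul, dotProduct,
          Fin.sum_univ_two, e3, e4,
          qFactorial_succ, qInt] <;>
        field_simp <;> ring
  · have e1 : (2 * j + 1 + (2 * j + 1 + 1) % 2 + 1) / 2 = j + 1 := by omega
    have e2 : (2 * j + 1 + 1) / 2 = j + 1 := by omega
    have e3 : (2 * j + 1) % 2 = 1 := by omega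
    have e4 : (2 * j + 1) / 2 = j := by omega
    have e5 : (2 * j + 1 + 1) % 2 = 0 := by omega
    have hl : lastMat x (2 * j + 1 + e) = lastMat x (1 + e) := by
      simp only [lastMat, show (2 * j + 1 + (e : ℕ)) % 2 = (1 + e) % 2 by omega]
    have hs : (-1 : K) ^ (j + 1) * (-x) ^ (j + 1) = x ^ (j + 1) := by
      rw [← mul_pow]; simp
    rw [e1, e2, hs, twistedDer, hl]
    fin_cases e <;>
      simp [altCoeff, lastMat, Matrix.mul_apply, Matrix.vecMul, dotProduct,
          Fin.sum_univ_two, e2, e3, e4, e5] <;>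
      field_simp

/-- The weighted number of fillings of a closed set is a coefficient of its matrix product. -/
theorem fillingSum_eq_altCoeff {x : K} (hx : ∀ k, 1 ≤ k → (x ^ 2) ^ k ≠ 1) (e : Fin 2)
    (L : List (ℕ × Bool)) (k : ℕ) (S : Finset (Fin (totalLen L)))
    (hS : ∀ i j : Fin (totalLen L), listRel L i j → j ∈ S → i ∈ S)
    (h1 : (S.filter fun i : Fin _ => (i : ℕ) % 2 = e % 2).card = (k + 1) / 2)
    (h2 : (S.filter fun i : Fin _ => ¬ (i : ℕ) % 2 = e % 2).card = k / 2) :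
    fillingSum (fun i j : Fin (totalLen L) => pairWeight x i j)
        (fun v i => (v + e) % 2 = i % 2) (fun i j => listRel L i j) k S =
      altCoeff x e k (prodMat x L (S.map Fin.valEmbedding)) := by
  classical
  induction k generalizing S with
  | zero =>
    have : S = ∅ := by
      rw [← Finset.card_eq_zero, ← Finset.card_filter_add_card_filter_not
        (fun i : Fin (totalLen L) => (i : ℕ) % 2 = e % 2), h1, h2]
    subst this
    have hone : ∀ L, prodMat x L ∅ = 1 := by
      intro L
      induction L with
      | nil => rfl
      | cons b L ih => simp [prodMat, ih, blockMat_zero]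
    rw [fillingSum_zero, Finset.map_empty, hone]
    simp [altCoeff]
  | succ k ih =>
    have hclosed : ∀ i j, listRel L i j → j ∈ S.map Fin.valEmbedding →
        i ∈ S.map Fin.valEmbedding := by
      intro i j hij hj
      obtain ⟨j', hj', rfl⟩ := Finset.mem_map.1 hj
      exact Finset.mem_map.2 ⟨⟨i, (lt_of_listRel hij).1⟩, hS _ _ hij hj', rfl⟩
    have hlt : ∀ j ∈ S.map Fin.valEmbedding, j < totalLen L := by
      intro j hj
      obtain ⟨j', -, rfl⟩ := Finset.mem_map.1 hj
      exact j'.2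
    have hder := twistedDer_prodMat hx (k + e) L hclosed
    -- The parity counts `h1` and `h2` determine this weight, and it is the scalar required by
    -- `altCoeff_twistedDer`.
    have hweight : ∏ j ∈ S.map Fin.valEmbedding with j < totalLen L, pairWeight x (k + e) j =
        (-1) ^ ((k + (k + 1) % 2 + 1) / 2) * (-x) ^ ((k + 1) / 2) := by
      rw [Finset.filter_true_of_mem hlt, Finset.prod_map]
      simp only [pairWeight, Fin.valEmbedding_apply]
      rw [Finset.prod_ite, Finset.prod_const, Finset.prod_const]
      rcases Nat.mod_two_eq_zero_or_one k with h | h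
      · have e1 : ∀ i : ℕ, (k + e) % 2 = i % 2 ↔ i % 2 = e % 2 := by omega
        simp only [e1, h1, h2]
        congr 2 <;> omega
      · have e1 : ∀ i : ℕ, (k + e) % 2 = i % 2 ↔ ¬ i % 2 = e % 2 := by omega
        simp only [e1, not_not, h1, h2]
        congr 2 <;> omega
    rw [hweight] at hder
    rw [← altCoeff_twistedDer hx, hder, altCoeff_sum_smul, fillingSum_succ]
    have hfil : ((S.map Fin.valEmbedding).filter fun i => i < totalLen L ∧ i % 2 = (k + e) % 2 ∧
          Removable (listRel L) (S.map Fin.valEmbedding) i) =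
        (S.filter fun a : Fin _ => (k + e) % 2 = (a : ℕ) % 2 ∧
          ∀ j ∈ S, ¬ listRel L a j).map Fin.valEmbedding := by
      ext i
      simp only [Finset.mem_filter, Finset.mem_map, Fin.valEmbedding_apply, Removable]
      constructor
      · rintro ⟨⟨a, ha, rfl⟩, -, h3, h4⟩
        exact ⟨a, ⟨ha, h3.symm, fun j hj => h4 j ⟨j, hj, rfl⟩⟩, rfl⟩
      · rintro ⟨a, ⟨ha, h3, h4⟩, rfl⟩
        refine ⟨⟨a, ha, rfl⟩, a.2, h3.symm, ?_⟩
        rintro _ ⟨j, hj, rfl⟩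
        exact h4 j hj
    rw [hfil, Finset.sum_map]
    refine Finset.sum_congr (by congr) fun a ha => ?_
    obtain ⟨haS, hpar, hrem⟩ := Finset.mem_filter.1 ha
    congr 1
    · have : ((S.map Fin.valEmbedding).filter fun j => Fin.valEmbedding a < j ∧ j < totalLen L) =
          (S.filter (a < ·)).map Fin.valEmbedding := by
        ext i
        simp only [Finset.mem_filter, Finset.mem_map, Fin.valEmbedding_apply]
        constructor
        · rintro ⟨⟨b, hb, rfl⟩, h3, -⟩
          exact ⟨b, ⟨hb, h3⟩, rfl⟩
        · rintro ⟨b, ⟨hb, h3⟩, rfl⟩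
          exact ⟨⟨b, hb, rfl⟩, h3, b.2⟩
      rw [this, Finset.prod_map]
      rfl
    · rw [← Finset.map_erase]
      refine ih _ (fun i j hij hj => ?_) ?_ ?_
      · obtain ⟨-, hj'⟩ := Finset.mem_erase.1 hj
        refine Finset.mem_erase.2 ⟨?_, hS i j hij hj'⟩
        rintro rfl
        exact hrem j hj' hij
      · rw [Finset.filter_erase]
        by_cases h : (a : ℕ) % 2 = e % 2
        · rw [Finset.card_erase_of_mem (Finset.mem_filter.2 ⟨haS, h⟩), h1]
          omega
        · rw [Finset.erase_eq_of_notMem (by simp [h]), h1]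
          omega
      · rw [Finset.filter_erase]
        by_cases h : (a : ℕ) % 2 = e % 2
        · rw [Finset.erase_eq_of_notMem (by simp [h]), h2]
          omega
        · rw [Finset.card_erase_of_mem (Finset.mem_filter.2 ⟨haS, h⟩), h2]
          omega

end
-- Block decompositions and connected components.
/-- The ascents prescribed by a list of blocks. -/
def incSet : List (ℕ × Bool) → Finset ℕ
  | [] => ∅
  | b :: L => if b.2 then incSet L else incSet L ∪ Finset.Ioo (totalLen L) (totalLen L + b.1)

/-- The descents prescribed by a list of blocks. -/
def decSet : List (ℕ × Bool) → Finset ℕ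
  | [] => ∅
  | b :: L => if b.2 then decSet L ∪ Finset.Ioo (totalLen L) (totalLen L + b.1) else decSet L

theorem listRel_iff (L : List (ℕ × Bool)) (i j : ℕ) :
    listRel L i j ↔ descentRel (incSet L) (decSet L) i j := by
  induction L with
  | nil => simp [listRel, descentRel, incSet, decSet]
  | cons b L ih =>
    obtain ⟨r, δ⟩ := b
    rw [listRel, ih]
    cases δ <;> simp [descentRel, incSet, decSet, blockRel] <;> constructor
    · rintro ((h | h) | ⟨h1, h2, h3⟩)
      · exact Or.inl ⟨Or.inl h.1, h.2⟩
      · exact Or.inr h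
      · exact Or.inl ⟨Or.inr (by omega), h3⟩
    · rintro (⟨h | h, h'⟩ | h)
      · exact Or.inl (Or.inl ⟨h, h'⟩)
      · exact Or.inr (by omega)
      · exact Or.inl (Or.inr h)
    · rintro ((h | h) | ⟨h1, h2, h3⟩)
      · exact Or.inl h
      · exact Or.inr ⟨Or.inl h.1, h.2⟩
      · exact Or.inr ⟨Or.inr (by omega), h3⟩
    · rintro (h | ⟨h | h, h'⟩)
      · exact Or.inl (Or.inl h)
      · exact Or.inl (Or.inr ⟨h, h'⟩)
      · exact Or.inr (by omega)

theorem Unmixed.filter {I J : Finset ℕ} (h : Unmixed I J) (p : ℕ → Prop) [DecidablePred p] :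
    Unmixed (I.filter p) (J.filter p) := by
  obtain ⟨h1, h2, h3⟩ := h
  unfold Unmixed
  simp only [Finset.eq_empty_iff_forall_notMem, Finset.mem_inter, Finset.mem_image] at *
  refine ⟨fun a ha => h1 a ?_, fun a ha => h2 a ?_, fun a ha => h3 a ?_⟩
  · exact ⟨(Finset.mem_filter.1 ha.1).1, (Finset.mem_filter.1 ha.2).1⟩
  · obtain ⟨⟨b, hb, e⟩, ha⟩ := ha
    exact ⟨⟨b, (Finset.mem_filter.1 hb).1, e⟩, (Finset.mem_filter.1 ha).1⟩
  · obtain ⟨ha, ⟨b, hb, e⟩⟩ := ha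
    exact ⟨(Finset.mem_filter.1 ha).1, ⟨b, (Finset.mem_filter.1 hb).1, e⟩⟩

/-- Cut at every index outside `I ∪ J`. Unmixedness forbids neighbouring elements of different type,
so each piece consists of ascents only or of descents only. -/
theorem exists_blocks (n : ℕ) {I J : Finset ℕ} (hI : I ⊆ Finset.Icc 1 (n - 1))
    (hJ : J ⊆ Finset.Icc 1 (n - 1)) (hIJ : Unmixed I J) :
    ∃ L, totalLen L = n ∧ incSet L = I ∧ decSet L = J := by
  induction n using Nat.strong_induction_on generalizing I J with
  | _ n ih =>
  rcases Nat.eq_zero_or_pos n with rfl | hn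
  · refine ⟨[], rfl, ?_, ?_⟩
    · exact (Finset.subset_empty.1 (by simpa using hI)).symm
    · exact (Finset.subset_empty.1 (by simpa using hJ)).symm
  have hI' : ∀ i ∈ I, 1 ≤ i ∧ i < n := fun i hi => by
    have := Finset.mem_Icc.1 (hI hi); omega
  have hJ' : ∀ i ∈ J, 1 ≤ i ∧ i < n := fun i hi => by
    have := Finset.mem_Icc.1 (hJ hi); omega
  obtain ⟨h1, h2, h3⟩ := hIJ
  have d1 : ∀ i ∈ I, i ∉ J := fun i hi hj => by
    have : i ∈ I ∩ J := Finset.mem_inter.2 ⟨hi, hj⟩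
    simp [h1] at this
  have d2 : ∀ i ∈ I, i + 1 ∉ J := fun i hi hj => by
    have : i + 1 ∈ I.image (· + 1) ∩ J :=
      Finset.mem_inter.2 ⟨Finset.mem_image_of_mem _ hi, hj⟩
    simp [h2] at this
  have d3 : ∀ i ∈ J, i + 1 ∉ I := fun i hj hi => by
    have : i + 1 ∈ I ∩ J.image (· + 1) :=
      Finset.mem_inter.2 ⟨hi, Finset.mem_image_of_mem _ hj⟩
    simp [h3] at this
  -- The last cut; the index `0` always qualifies. The last block has length `n - a ≥ 1`.
  let a := Nat.findGreatest (fun a => a ∉ I ∪ J) (n - 1)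
  have ha0 : a ∉ I ∪ J := by
    refine Nat.findGreatest_spec (P := fun a => a ∉ I ∪ J) (Nat.zero_le _) fun h => ?_
    rcases Finset.mem_union.1 h with h | h
    · exact absurd (hI' 0 h).1 (by omega)
    · exact absurd (hJ' 0 h).1 (by omega)
  have han : a ≤ n - 1 := Nat.findGreatest_le _
  have hgt : ∀ i, a < i → i < n → i ∈ I ∨ i ∈ J := fun i h h' => by
    have := Nat.findGreatest_is_greatest (P := fun a => a ∉ I ∪ J) (n := n - 1) h (by omega)
    simpa [or_iff_not_imp_left] using this
  obtain ⟨L, hL, hLI, hLJ⟩ := ih a (by omega) (I := I.filter (· < a)) (J := J.filter (· < a))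
    (fun i hi => by
      have := Finset.mem_filter.1 hi
      have := hI' i this.1
      exact Finset.mem_Icc.2 (by omega))
    (fun i hi => by
      have := Finset.mem_filter.1 hi
      have := hJ' i this.1
      exact Finset.mem_Icc.2 (by omega))
    (Unmixed.filter ⟨h1, h2, h3⟩ _)
  have haI : a ∉ I := fun h => ha0 (Finset.mem_union_left _ h)
  have haJ : a ∉ J := fun h => ha0 (Finset.mem_union_right _ h)
  -- The type of `n - 1` decides that of the last block; a block of length one is counted as
  -- increasing.
  by_cases hd : n - 1 ∈ J
  · have hall : ∀ k, a < n - 1 - k → n - 1 - k ∈ J := by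
      intro k
      induction k with
      | zero => intro _; exact hd
      | succ k ihk =>
        intro hk
        refine (hgt _ hk (by omega)).resolve_left fun h => ?_
        refine d2 _ h ?_
        rw [show n - 1 - (k + 1) + 1 = n - 1 - k by omega]
        exact ihk (by omega)
    have hall' : ∀ i, a < i → i < n → i ∈ J := fun i h h' => by
      have := hall (n - 1 - i) (by omega)
      rwa [show n - 1 - (n - 1 - i) = i by omega] at this
    refine ⟨(n - a, true) :: L, by simp only [totalLen, hL]; omega, ?_, ?_⟩
    · simp only [incSet, hLI, if_true]
      refine Finset.filter_true_of_mem fun i hi => ?_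
      by_contra h
      rcases eq_or_ne i a with rfl | hia
      · exact haI hi
      · exact d1 i hi (hall' i (by omega) (hI' i hi).2)
    · simp only [decSet, hLJ, if_true, hL]
      ext i
      rw [Finset.mem_union, Finset.mem_filter, Finset.mem_Ioo]
      constructor
      · rintro (h | h)
        · exact h.1
        · exact hall' i h.1 (by omega)
      · intro h
        rcases lt_trichotomy i a with h' | rfl | h'
        · exact Or.inl ⟨h, h'⟩
        · exact absurd h haJ
        · exact Or.inr ⟨h', by have := (hJ' i h).2; omega⟩
  · have hall : ∀ k, a < n - 1 - k → n - 1 - k ∈ I := by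
      intro k
      induction k with
      | zero => intro h; exact (hgt _ h (by omega)).resolve_right hd
      | succ k ihk =>
        intro hk
        refine (hgt _ hk (by omega)).resolve_right fun h => ?_
        refine d3 _ h ?_
        rw [show n - 1 - (k + 1) + 1 = n - 1 - k by omega]
        exact ihk (by omega)
    have hall' : ∀ i, a < i → i < n → i ∈ I := fun i h h' => by
      have := hall (n - 1 - i) (by omega)
      rwa [show n - 1 - (n - 1 - i) = i by omega] at this
    refine ⟨(n - a, false) :: L, by simp only [totalLen, hL]; omega, ?_, ?_⟩
    · simp only [incSet, hLI, Bool.false_eq_true, if_false, hL]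
      ext i
      rw [Finset.mem_union, Finset.mem_filter, Finset.mem_Ioo]
      constructor
      · rintro (h | h)
        · exact h.1
        · exact hall' i h.1 (by omega)
      · intro h
        rcases lt_trichotomy i a with h' | rfl | h'
        · exact Or.inl ⟨h, h'⟩
        · exact absurd h haI
        · exact Or.inr ⟨h', by have := (hI' i h).2; omega⟩
    · simp only [decSet, hLJ, Bool.false_eq_true, if_false]
      refine Finset.filter_true_of_mem fun i hi => ?_
      by_contra h
      rcases eq_or_ne i a with rfl | hia
      · exact haJ hi
      · exact d1 i (hall' i (by omega) (hJ' i hi).2) hi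

/-- A component is an interval `[a, b]` contained in `I` that is maximal on both sides. -/
theorem mem_components {I K : Finset ℕ} :
    K ∈ components I ↔ ∃ a b, a ≤ b ∧ Finset.Icc a b ⊆ I ∧ (∀ c ∈ I, c + 1 ≠ a) ∧ b + 1 ∉ I ∧
      Finset.Icc a b = K := by
  simp only [components, Finset.mem_image, Finset.mem_filter, Finset.mem_product, Prod.exists]
  constructor
  · rintro ⟨a, b, ⟨-, h1, h2, h3, h4⟩, h5⟩
    exact ⟨a, b, h1, h2, h3, h4, h5⟩
  · rintro ⟨a, b, h1, h2, h3, h4, h5⟩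
    exact ⟨a, b, ⟨⟨h2 (Finset.left_mem_Icc.2 h1), h2 (Finset.right_mem_Icc.2 h1)⟩,
      h1, h2, h3, h4⟩, h5⟩

/-- Appending a separated interval adds one component. -/
theorem components_union_Ioo {I : Finset ℕ} {n r : ℕ} (hI : ∀ i ∈ I, i < n) (hr : 2 ≤ r) :
    components (I ∪ Finset.Ioo n (n + r)) = insert (Finset.Ioo n (n + r)) (components I) := by
  have e : Finset.Ioo n (n + r) = Finset.Icc (n + 1) (n + r - 1) := by
    ext i; simp only [Finset.mem_Ioo, Finset.mem_Icc]; omega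
  have hmem : ∀ i, i ∈ I ∪ Finset.Ioo n (n + r) ↔ i ∈ I ∨ (n < i ∧ i < n + r) := by simp
  ext K
  rw [Finset.mem_insert, mem_components, mem_components]
  constructor
  · rintro ⟨a, b, h1, h2, h3, h4, rfl⟩
    have hsub : ∀ i, a ≤ i → i ≤ b → i ∈ I ∨ (n < i ∧ i < n + r) := fun i h h' =>
      (hmem i).1 (h2 (Finset.mem_Icc.2 ⟨h, h'⟩))
    have hn : n ∉ Finset.Icc a b := fun h => by
      have h' := Finset.mem_Icc.1 h
      rcases hsub n h'.1 h'.2 with h | h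
      · exact absurd (hI n h) (lt_irrefl n)
      · omega
    rw [Finset.mem_Icc] at hn
    rcases lt_or_ge b n with hb | hb
    · refine Or.inr ⟨a, b, h1, fun i hi => ?_, fun c hc => h3 c ((hmem c).2 (Or.inl hc)),
        fun h => h4 ((hmem _).2 (Or.inl h)), rfl⟩
      have := Finset.mem_Icc.1 hi
      exact (hsub i this.1 this.2).resolve_right (by omega)
    · left
      have ha : n < a := by omega
      have ha' : a = n + 1 := by
        by_contra hne
        have := (hsub a le_rfl h1).resolve_left fun h => by have := hI a h; omega
        exact h3 (a - 1) ((hmem _).2 (Or.inr (by omega))) (by omega)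
      have hb1 := (hsub b h1 le_rfl).resolve_left fun h => by have := hI b h; omega
      have hb2 : ¬ (b + 1 < n + r) := fun h => h4 ((hmem _).2 (Or.inr (by omega)))
      rw [e, ha', show b = n + r - 1 by omega]
  · rintro (rfl | ⟨a, b, h1, h2, h3, h4, rfl⟩)
    · refine ⟨n + 1, n + r - 1, by omega, ?_, fun c hc => ?_, fun h => ?_, e.symm⟩
      · rw [← e]; exact Finset.subset_union_right
      · rcases (hmem c).1 hc with h | h
        · have := hI c h; omega
        · omega
      · rcases (hmem _).1 h with h | h
        · have := hI _ h; omega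
        · omega
    · have hb := hI b (h2 (Finset.right_mem_Icc.2 h1))
      refine ⟨a, b, h1, fun i hi => (hmem i).2 (Or.inl (h2 hi)), fun c hc => ?_, fun h => ?_, rfl⟩
      · rcases (hmem c).1 hc with h | h
        · exact h3 c h
        · omega
      · rcases (hmem _).1 h with h | h
        · exact h4 h
        · omega

/-- A block of length `r` prescribes `r - 1` indices, hence the part `⌊((r - 1) + 1)/2⌋`; for `r <
2` there is no component. -/
theorem parts_union_Ioo {I : Finset ℕ} {n r : ℕ} (hI : ∀ i ∈ I, i < n) :
    parts (I ∪ Finset.Ioo n (n + r)) = if 2 ≤ r then r / 2 ::ₘ parts I else parts I := by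
  split_ifs with hr
  · have hnot : Finset.Ioo n (n + r) ∉ components I := fun h => by
      obtain ⟨a, b, h1, h2, -, -, e⟩ := mem_components.1 h
      have h3 : n + 1 ∈ Finset.Icc a b := by rw [e, Finset.mem_Ioo]; omega
      have := hI _ (h2 h3)
      omega
    rw [parts, components_union_Ioo hI hr, Finset.insert_val_of_notMem hnot, Multiset.map_cons,
      parts]
    congr 1
    rw [Nat.card_Ioo]
    congr 1
    omega
  · have : Finset.Ioo n (n + r) = ∅ := by
      ext i; simp only [Finset.mem_Ioo, Finset.notMem_empty, iff_false]; omega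
    rw [this, Finset.union_empty]

theorem lt_of_mem_incSet {L : List (ℕ × Bool)} {i : ℕ} (h : i ∈ incSet L) : i < totalLen L := by
  induction L with
  | nil => simp [incSet] at h
  | cons b L ih =>
    rw [incSet] at h
    simp only [totalLen]
    split_ifs at h
    · have := ih h; omega
    · rcases Finset.mem_union.1 h with h | h
      · have := ih h; omega
      · exact (Finset.mem_Ioo.1 h).2

theorem lt_of_mem_decSet {L : List (ℕ × Bool)} {i : ℕ} (h : i ∈ decSet L) : i < totalLen L := by
  induction L with
  | nil => simp [decSet] at h
  | cons b L ih =>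
    rw [decSet] at h
    simp only [totalLen]
    split_ifs at h
    · rcases Finset.mem_union.1 h with h | h
      · have := ih h; omega
      · exact (Finset.mem_Ioo.1 h).2
    · have := ih h; omega

/-- The sum of `⌊r/2⌋` over the increasing blocks. -/
def incSum : List (ℕ × Bool) → ℕ
  | [] => 0
  | b :: L => incSum L + if b.2 then 0 else b.1 / 2

/-- The sum of `⌊r/2⌋` over the decreasing blocks. -/
def decSum : List (ℕ × Bool) → ℕ
  | [] => 0
  | b :: L => decSum L + if b.2 then b.1 / 2 else 0

/-- The sum of `⌊r/2⌋ ^ 2` over the decreasing blocks. -/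
def decSqSum : List (ℕ × Bool) → ℕ
  | [] => 0
  | b :: L => decSqSum L + if b.2 then (b.1 / 2) ^ 2 else 0

/-- The number of blocks of odd length. -/
def oddCount : List (ℕ × Bool) → ℕ
  | [] => 0
  | b :: L => oddCount L + b.1 % 2

theorem totalLen_eq (L : List (ℕ × Bool)) :
    totalLen L = 2 * (incSum L + decSum L) + oddCount L := by
  induction L with
  | nil => rfl
  | cons b L ih =>
    obtain ⟨r, δ⟩ := b
    cases δ <;> simp [totalLen, incSum, decSum, oddCount, ih] <;> omega

/-! ### The closed form of the full product. -/

section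
variable {K : Type*} [Field K]

/-- The product of the `[⌊r/2⌋]_q!` over all blocks. -/
def facProd (q : K) : List (ℕ × Bool) → K
  | [] => 1
  | b :: L => qFactorial q (b.1 / 2) * facProd q L

/-- Blocks of even length are diagonal. Those of odd length are alternately multiples of `E₀₁` and
of `(1 - x^2) E₁₀`, since their starting parity alternates; the first one starts at an even position
and so kills the lower row for good. Each completed pair leaves a factor `1 - x^2`. -/
theorem prodMat_range (x : K) (L : List (ℕ × Bool)) {N : ℕ} (hN : totalLen L ≤ N) :
    prodMat x L (Finset.range N) =
      ((-1) ^ decSum L * x ^ decSqSum L * (facProd (x ^ 2) L)⁻¹) •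
        if oddCount L % 2 = 0 then
          !![x ^ decSum L * (1 - x ^ 2) ^ (oddCount L / 2), 0;
            0, if oddCount L = 0 then x ^ incSum L else 0]
        else !![0, x ^ decSum L * (1 - x ^ 2) ^ (oddCount L / 2); 0, 0] := by
  induction L with
  | nil => simp [prodMat, decSum, decSqSum, incSum, facProd, oddCount, Matrix.one_fin_two]
  | cons b L ih =>
    obtain ⟨r, δ⟩ := b
    simp only [totalLen] at hN
    have hcard : (Finset.range N ∩ Finset.Ico (totalLen L) (totalLen L + r)).card = r := by
      rw [Finset.inter_eq_right.2, Nat.card_Ico, Nat.add_sub_cancel_left]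
      intro i hi
      have := (Finset.mem_Ico.1 hi).2
      exact Finset.mem_range.2 (by omega)
    have hlen := totalLen_eq L
    have hpar : totalLen L % 2 = oddCount L % 2 := by omega
    rw [prodMat, ih (by omega), hcard]
    simp only [decSum, decSqSum, incSum, facProd, oddCount, mul_inv]
    generalize (facProd (x ^ 2) L)⁻¹ = F
    have hz : (0 : Fin 2 → K) = ![0, 0] := by ext i; fin_cases i <;> rfl
    generalize totalLen L = p at *
    obtain ⟨k, rfl | rfl⟩ := Nat.even_or_odd' r
    · have e1 : 2 * k / 2 = k := by omega
      have e2 : 2 * k % 2 = 0 := by omega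
      have e3 : (2 * k + 1) / 2 = k := by omega
      -- Empty blocks are set apart because the truncated `p + 2 * k - 1` has the wrong parity when
      -- `p = k = 0`.
      rcases Nat.eq_zero_or_pos k with rfl | hk
      · simp [blockMat_zero, qFactorial_zero]
      have e4 : (p + 2 * k - 1) % 2 = (oddCount L + 1) % 2 := by omega
      obtain ⟨h, hh | hh⟩ := Nat.even_or_odd' (oddCount L)
      · have e5 : 2 * h % 2 = 0 := by omega
        have e6 : (2 * h + 1) % 2 = 1 := by omega
        cases δ <;> by_cases h0 : h = 0 <;>
        · simp [blockMat, altMat, decScale, e1, e2, e3, e4, e5, e6, hpar, hh, h0]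
          ring_nf
          try simp
          try first | exact hz | exact fun _ => hz
      · have e5 : (2 * h + 1) % 2 = 1 := by omega
        have e6 : (2 * h + 1 + 1) % 2 = 0 := by omega
        cases δ <;>
        · simp [blockMat, altMat, decScale, e1, e2, e3, e4, e5, e6, hpar, hh]
          ring_nf
          try simp
          try exact hz
    · have e1 : (2 * k + 1) / 2 = k := by omega
      have e2 : (2 * k + 1) % 2 = 1 := by omega
      have e3 : (2 * k + 1 + 1) / 2 = k + 1 := by omega
      obtain ⟨h, hh | hh⟩ := Nat.even_or_odd' (oddCount L)
      · have e5 : 2 * h % 2 = 0 := by omega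
        have e6 : (2 * h + 1) / 2 = h := by omega
        have e7 : (2 * h + 1) % 2 = 1 := by omega
        cases δ <;>
        · simp [blockMat, altMat, decScale, e1, e2, e3, e5, e6, e7, hpar, hh]
          ring_nf
          try simp
          try first | exact hz | exact fun _ => hz
      · have e5 : (2 * h + 1) % 2 = 1 := by omega
        have e6 : (2 * h + 1) / 2 = h := by omega
        have e7 : (2 * h + 1 + 1) % 2 = 0 := by omega
        have e8 : (2 * h + 1 + 1) / 2 = h + 1 := by omega
        cases δ <;>
        · simp [blockMat, altMat, decScale, e1, e2, e3, e5, e6, e7, e8, hpar, hh]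
          ring_nf
          try simp
          try exact hz

theorem prod_parts (q : K) (L : List (ℕ × Bool)) :
    ((parts (incSet L)).map (qFactorial q)).prod * ((parts (decSet L)).map (qFactorial q)).prod =
      facProd q L := by
  induction L with
  | nil => simp [incSet, decSet, facProd, parts, components]
  | cons b L ih =>
    obtain ⟨r, δ⟩ := b
    cases δ
    · simp only [incSet, decSet, Bool.false_eq_true, if_false, facProd, ← ih,
        parts_union_Ioo (fun _ => lt_of_mem_incSet)]
      split_ifs with h
      · simp [mul_assoc]
      · simp [show r / 2 = 0 by omega, qFactorial_zero]
    · simp only [incSet, decSet, if_true, facProd, ← ih,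
        parts_union_Ioo (fun _ => lt_of_mem_decSet)]
      split_ifs with h
      · simp [mul_left_comm]
      · simp [show r / 2 = 0 by omega, qFactorial_zero]

/-- `[M+c]_q! (1-q)^c = [M]_q! ∏_{k=M+1}^{M+c} (1-q^k)`. -/
theorem qFactorial_add {q : K} (hq : q ≠ 1) (M c : ℕ) :
    qFactorial q (M + c) * (1 - q) ^ c =
      qFactorial q M * ∏ k ∈ Finset.Icc (M + 1) (M + c), (1 - q ^ k) := by
  induction c with
  | zero => simp
  | succ c ih =>
    rw [← add_assoc, qFactorial_succ, Finset.prod_Icc_succ_top (by omega), ← mul_assoc, ← ih, qInt,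
      pow_succ]
    have : 1 - q ≠ 0 := sub_ne_zero.2 hq.symm
    field_simp
    ring

end

theorem sum_parts_incSet (L : List (ℕ × Bool)) : (parts (incSet L)).sum = incSum L := by
  induction L with
  | nil => simp [incSet, incSum, parts, components]
  | cons b L ih =>
    obtain ⟨r, δ⟩ := b
    cases δ
    · simp only [incSet, Bool.false_eq_true, if_false, incSum, ← ih,
        parts_union_Ioo (fun _ => lt_of_mem_incSet)]
      split_ifs with h
      · simp [add_comm]
      · simp [show r / 2 = 0 by omega]
    · simp [incSet, incSum, ih]

theorem sum_map_parts_decSet {f : ℕ → ℕ} (hf : f 0 = 0) (L : List (ℕ × Bool)) :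
    ((parts (decSet L)).map f).sum = (L.map fun b => if b.2 then f (b.1 / 2) else 0).sum := by
  induction L with
  | nil => simp [decSet, parts, components]
  | cons b L ih =>
    obtain ⟨r, δ⟩ := b
    cases δ
    · simp [decSet, ih]
    · simp only [decSet, if_true, List.map_cons, List.sum_cons, ← ih,
        parts_union_Ioo (fun _ => lt_of_mem_decSet)]
      split_ifs with h
      · simp
      · simp [show r / 2 = 0 by omega, hf]

theorem sum_parts_decSet (L : List (ℕ × Bool)) : (parts (decSet L)).sum = decSum L := by
  have h := sum_map_parts_decSet (f := id) rfl L
  rw [Multiset.map_id] at h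
  rw [h]
  change (L.map fun b => if b.2 then b.1 / 2 else 0).sum = _
  clear h
  induction L with
  | nil => rfl
  | cons b L ih => simp only [List.map_cons, List.sum_cons, ih, decSum, add_comm]

theorem sum_sq_parts_decSet (L : List (ℕ × Bool)) :
    ((parts (decSet L)).map fun k => k ^ 2).sum = decSqSum L := by
  rw [sum_map_parts_decSet (by rfl)]
  induction L with
  | nil => rfl
  | cons b L ih => simp only [List.map_cons, List.sum_cons, ih, decSqSum, add_comm]

theorem card_filter_mod_two (n e : ℕ) (h : n % 2 = 0 ∨ e % 2 = 0) :
    ((Finset.univ : Finset (Fin n)).filter fun i : Fin n => (i : ℕ) % 2 = e % 2).card =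
      (n + 1) / 2 ∧
    ((Finset.univ : Finset (Fin n)).filter fun i : Fin n => ¬ (i : ℕ) % 2 = e % 2).card =
      n / 2 := by
  have key : ∀ n e : ℕ, ((Finset.univ : Finset (Fin n)).filter
      fun i : Fin n => (i : ℕ) % 2 = e % 2).card = (n + 1 - e % 2) / 2 := by
    intro n e
    induction n generalizing e with
    | zero => simp; omega
    | succ n ih =>
      have hs : ∀ i : Fin n, ((i.succ : Fin (n + 1)) : ℕ) % 2 = e % 2 ↔
          (i : ℕ) % 2 = (e + 1) % 2 := fun i => by rw [Fin.val_succ]; omega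
      rw [Fin.card_filter_univ_succ]
      simp only [hs, ih, Fin.val_zero]
      split_ifs <;> omega
  have hs := Finset.card_filter_add_card_filter_not (s := (Finset.univ : Finset (Fin n)))
    (fun i : Fin n => (i : ℕ) % 2 = e % 2)
  rw [key, Finset.card_univ, Fintype.card_fin] at hs
  rw [key]
  omega

/-! ### Assembly of the three formulas. -/

section
variable {K : Type*} [Field K] [Algebra ℤ K]

/-- The signed generating function as a coefficient of a product of block matrices. -/
theorem aeval_signedGF_eq_altCoeff {x : K} (hx : ∀ k, 1 ≤ k → (x ^ 2) ^ k ≠ 1) (e : Fin 2)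
    {L : List (ℕ × Bool)} {n : ℕ} (hL : totalLen L = n)
    (hI : decSet L ⊆ Finset.Icc 1 (n - 1)) (he : n % 2 = 0 ∨ (e : ℕ) % 2 = 0)
    {X : Finset (Equiv.Perm (Fin n))}
    (hX : ∀ σ, σ ∈ X ↔ ∀ i : Fin n, ((σ i : ℕ) + e) % 2 = i % 2) :
    Polynomial.aeval x (signedGF (descentClass (incSet L) (decSet L) X)) =
      altCoeff x e n (prodMat x L (Finset.range n)) := by
  subst hL
  rw [aeval_signedGF x hI e hX]
  simp only [← listRel_iff]
  obtain ⟨h1, h2⟩ := card_filter_mod_two (totalLen L) e he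
  rw [fillingSum_eq_altCoeff hx e L _ _ (fun _ _ _ _ => Finset.mem_univ _) h1 h2]
  congr 2
  ext i
  simp only [Finset.mem_map, Finset.mem_univ, true_and, Fin.valEmbedding_apply, Finset.mem_range]
  exact ⟨fun ⟨a, ha⟩ => ha ▸ a.2, fun h => ⟨⟨i, h⟩, rfl⟩⟩

end

theorem X_pow_ne_one {k : ℕ} (hk : 1 ≤ k) : ((RatFunc.X : RatFunc ℚ) ^ 2) ^ k ≠ 1 := by
  rw [← pow_mul, ← RatFunc.algebraMap_X, ← map_pow, ← map_one (algebraMap ℚ[X] (RatFunc ℚ)),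
    (RatFunc.algebraMap_injective ℚ).ne_iff]
  intro h
  have := congrArg Polynomial.natDegree h
  rw [Polynomial.natDegree_X_pow, Polynomial.natDegree_one] at this
  omega

end OddLength

theorem mainTheorem1 (n : ℕ) (hn : 1 ≤ n) (I J : Finset ℕ)
    (hI : I ⊆ Finset.Icc 1 (n - 1)) (hJ : J ⊆ Finset.Icc 1 (n - 1))
    (hIJ : OddLength.Unmixed I J)
    (b d M m α : ℕ)
    (hb : b = (OddLength.parts I).sum) (hd : d = (OddLength.parts J).sum)
    (hM : M = b + d) (hm : m = n / 2)
    (hα : α = ((OddLength.parts J).map fun k => k ^ 2).sum)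
    (x mult : RatFunc ℚ) (hx : x = RatFunc.X)
    (hmult : mult =
      OddLength.qMultinomial (x ^ 2) M (OddLength.parts I + OddLength.parts J)) :
    (Odd n →
      Polynomial.aeval x (OddLength.signedGF
          (OddLength.descentClass I J (OddLength.evenChess n))) =
        (-x) ^ d * x ^ α * mult * ∏ k ∈ Finset.Icc (M + 1) m, (1 - x ^ (2 * k))) ∧
    (Even n →
      Polynomial.aeval x (OddLength.signedGF
          (OddLength.descentClass I J (OddLength.evenChess n))) =
        (if m = M then
          (-x) ^ d * x ^ α *
            (OddLength.qInt (x ^ 2) b / OddLength.qInt (x ^ 2) m) * mult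
        else
          (-x) ^ d * x ^ α * mult * ∏ k ∈ Finset.Icc (M + 1) (m - 1), (1 - x ^ (2 * k)))) ∧
    (Even n →
      Polynomial.aeval x (OddLength.signedGF
          (OddLength.descentClass I J (OddLength.oddChess n))) =
        (if m = M then
          (-1) ^ d * x ^ (b + α) *
            (OddLength.qInt (x ^ 2) d / OddLength.qInt (x ^ 2) m) * mult
        else
          -(-x) ^ d * x ^ (m + α) * mult *
            ∏ k ∈ Finset.Icc (M + 1) (m - 1), (1 - x ^ (2 * k)))) := by
  have hq : ∀ k, 1 ≤ k → (x ^ 2) ^ k ≠ 1 := fun k hk => hx ▸ OddLength.X_pow_ne_one hk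
  obtain ⟨L, hL, rfl, rfl⟩ := OddLength.exists_blocks n hI hJ hIJ
  rw [OddLength.sum_parts_incSet] at hb
  rw [OddLength.sum_parts_decSet] at hd
  rw [OddLength.sum_sq_parts_decSet] at hα
  rw [OddLength.qMultinomial, Multiset.map_add, Multiset.prod_add, OddLength.prod_parts] at hmult
  have hlen := OddLength.totalLen_eq L
  have hmat := OddLength.prodMat_range x L hL.le
  rw [hL, ← hb, ← hd] at hlen
  rw [← hb, ← hd, ← hα] at hmat
  generalize OddLength.oddCount L = o at *
  have heven := OddLength.aeval_signedGF_eq_altCoeff hq 0 hL hJ (Or.inr rfl)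
    (X := OddLength.evenChess n) (fun σ => by
      rw [OddLength.evenChess, Finset.mem_filter, and_iff_right (Finset.mem_univ σ)]
      refine forall_congr' fun i => ?_
      simp only [Nat.ModEq, Fin.val_zero]
      omega)
  have hodd := fun he => OddLength.aeval_signedGF_eq_altCoeff hq 1 hL hJ (Or.inl he)
    (X := OddLength.oddChess n) (fun σ => by
      rw [OddLength.oddChess, Finset.mem_filter, and_iff_right (Finset.mem_univ σ)]
      refine forall_congr' fun i => ?_
      simp only [Nat.ModEq, Fin.val_one]
      omega)
  rw [hmat] at heven hodd
  have h1 : 1 - x ^ 2 ≠ 0 := sub_ne_zero.2 (by simpa using (hq 1 le_rfl).symm)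
  have hprod : ∀ c, OddLength.qFactorial (x ^ 2) (M + c) * (1 - x ^ 2) ^ c =
      OddLength.qFactorial (x ^ 2) M * ∏ k ∈ Finset.Icc (M + 1) (M + c), (1 - x ^ (2 * k)) := by
    intro c
    rw [OddLength.qFactorial_add (by simpa using hq 1 le_rfl)]
    simp only [pow_mul]
  have hquot : 1 ≤ M → ∀ r, OddLength.qInt (x ^ 2) r / OddLength.qInt (x ^ 2) M *
      OddLength.qFactorial (x ^ 2) M =
      OddLength.qFactorial (x ^ 2) (M - 1) * (1 - (x ^ 2) ^ r) / (1 - x ^ 2) := by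
    intro hM1 r
    obtain ⟨M', hM'⟩ : ∃ M', M = M' + 1 := ⟨M - 1, by omega⟩
    have := OddLength.qInt_ne_zero hq hM1
    rw [hM', Nat.add_sub_cancel, OddLength.qFactorial_succ, ← hM']
    field_simp
    rw [OddLength.qInt]
    field_simp
  refine ⟨fun h => ?_, fun h => ?_, fun h => ?_⟩
  · rw [Nat.odd_iff] at h
    -- Here `c = m - M`, and `hprod` turns `[m]! (1 - x^2)^c` into `[M]!` times the product in the
    -- claim.
    obtain ⟨c, rfl⟩ : ∃ c, o = 2 * c + 1 := ⟨o / 2, by omega⟩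
    have hc := hprod c
    rw [heven, hmult, OddLength.altCoeff, if_neg (by omega), if_pos h, if_neg (by omega),
      ← hm, show m = M + c by omega, neg_pow x]
    simp [show (2 * c + 1) / 2 = c by omega]
    linear_combination (-1) ^ d * x ^ α * x ^ d * (OddLength.facProd (x ^ 2) L)⁻¹ * hc
  · rw [Nat.even_iff] at h
    obtain ⟨c, rfl⟩ : ∃ c, o = 2 * c := ⟨o / 2, by omega⟩
    rw [heven, hmult, OddLength.altCoeff, if_neg (by omega), if_neg (by omega), ← hm,
      neg_pow x, div_eq_mul_inv _ (OddLength.facProd _ _)]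
    generalize (OddLength.facProd (x ^ 2) L)⁻¹ = F
    rcases c with _ | c
    -- Without odd blocks both diagonal entries survive, and `x^d - x^(m+b) = x^d (1 - x^(2b))`
    -- yields `[b]`.
    · rw [if_pos (show m = M by omega), show m = M by omega]
      have hbm := hquot (by omega) b
      simp
      rw [show M = b + d by omega] at *
      linear_combination -(-1) ^ d * x ^ α * x ^ d * F * hbm
    -- Only the entry at `(0, 0)` survives. The division in `altCoeff` uses up one factor `1 - x^2`,
    -- so the product stops at `m - 1`.
    · rw [if_neg (show m ≠ M by omega)]
      have hc := hprod c
      rw [show m - 1 = M + c by omega]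
      simp [pow_succ]
      field_simp
      linear_combination x ^ α * x ^ d * F * hc
  · rw [Nat.even_iff] at h
    obtain ⟨c, rfl⟩ : ∃ c, o = 2 * c := ⟨o / 2, by omega⟩
    rw [hodd h, hmult, OddLength.altCoeff, if_neg (by omega), if_neg (by omega), ← hm,
      neg_pow x, div_eq_mul_inv _ (OddLength.facProd _ _)]
    generalize (OddLength.facProd (x ^ 2) L)⁻¹ = F
    rcases c with _ | c
    -- The diagonal entries exchange their roles: `x^b - x^(m+d) = x^b (1 - x^(2d))` yields `[d]`.
    · rw [if_pos (show m = M by omega), show m = M by omega]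
      have hdm := hquot (by omega) d
      simp
      rw [show M = b + d by omega] at *
      linear_combination -(-1) ^ d * x ^ α * x ^ b * F * hdm
    -- The surviving entry is now the subtracted one, which is the source of the factor `-x^m`.
    · rw [if_neg (show m ≠ M by omega)]
      have hc := hprod c
      rw [show m - 1 = M + c by omega]
      simp [pow_succ]
      field_simp
      linear_combination -x ^ α * x ^ d * x ^ m * F * hc
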